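/- Let $\mathbb H$ be the upper half-plane, $q=e^{2\pi i\tau}$, $E_2(\tau)=1-24\sum_{n\ge1}\sigma_1(n)q^n$ the quasimodular Eisenstein series of weight $2$ and $\eta(\tau)=q^{1/24}\prod_{n\ge1}(1-q^n)$ the Dedekind eta function. Put $$E^0_6(\tau)=E_2(\tau)-10E_2(2\tau)+15E_2(3\tau)-6E_2(6\tau),\qquad E^1_6(\tau)=3E_2(3\tau)-2E_2(2\tau),$$ $$t_6(\tau)=\left(\frac{\eta(6\tau)\,\eta(\tau)}{\eta(3\tau)\,\eta(2\tau)}\right)^{12}.$$ Let $\Gamma_0(6)^\star$ be the group generated by $\Gamma_0(6)$ and the Fricke involution $W_6=\begin{pmatrix}0&-1\\6&0\end{pmatrix}$, acting on $\mathbb H$ by Möbius transformations. An automorphic function for $\Gamma_0(6)^\star$ is a $\Gamma_0(6)^\star$-invariant meromorphic function on $\mathbb H$ that is meromorphic at all cusps, and a Hauptmodul of $\Gamma_0(6)^\star$ is a nonconstant automorphic function (possibly with poles in $\mathbb H$) that generates the field of all automorphic functions for $\Gamma_0(6)^\star$ over $\mathbb C$. Then $E^0_6/E^1_6$ is a Hauptmodul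 of $\Gamma_0(6)^\star$. Moreover, $t_6$ is a Hauptmodul of $\Gamma_0(6)^\star$, the functions $E^1_6$ and $1-5t_6$ have the same zeros in $\mathbb H$, and at every point of $\mathbb H$ where they do not vanish $$-\frac1{24}\,\frac{E^0_6}{E^1_6}=\frac{t_6}{1-5t_6},$$ so that, up to the factor $-\frac1{24}$, the ratio $E^0_6/E^1_6$ is a Möbius transform of $t_6$. -/

import Mathlib

open Filter Topology UpperHalfPlane
open scoped MatrixGroups Polynomial

noncomputable section

/-- The point `d τ` of the upper half-plane, for a positive integer `d`. -/
def dilate (d : ℕ) [NeZero d] (τ : ℍ) : ℍ :=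
  ⟨(d : ℂ) * (τ : ℂ), by
    have hd : (0 : ℝ) < d := Nat.cast_pos.mpr (Nat.pos_of_ne_zero (NeZero.ne d))
    have h := mul_pos hd τ.im_pos
    simpa using h⟩

/-- The matrix `W_N = (0, -1; N, 0)` of the Fricke involution `τ ↦ -1/(Nτ)`. -/
def frickeMatrix (N : ℕ) [NeZero N] : GL (Fin 2) ℝ :=
  Matrix.GeneralLinearGroup.mkOfDetNeZero !![0, -1; (N : ℝ), 0] (by
    simp [Matrix.det_fin_two_of, NeZero.ne N])

/-- The group `Γ₀(N)*`, generated by `Γ₀(N)` and the Fricke involution `W_N`. -/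
def Gamma0Star (N : ℕ) [NeZero N] : Subgroup (GL (Fin 2) ℝ) :=
  (CongruenceSubgroup.Gamma0 N).map (Matrix.SpecialLinearGroup.mapGL ℝ) ⊔
    Subgroup.closure {frickeMatrix N}

/-- `f` is meromorphic at the cusp `c`: for each `g ∈ SL(2, ℝ)` with `g ∞ = c`, the function
`τ ↦ f (g τ)` is, for `Im τ` large, equal to `F (exp (2πiτ / w))` for a width `w > 0` and a
function `F` that is meromorphic at `0`.  As for all meromorphic functions here, the equality is
one off a closed discrete set of points of `ℍ`: the values of `f` at its poles carry no meaning. -/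
def MeromorphicAtCusp (f : ℍ → ℂ) (c : OnePoint ℝ) : Prop :=
  ∀ g : SL(2, ℝ), (g : GL (Fin 2) ℝ) • (OnePoint.infty : OnePoint ℝ) = c →
    ∃ w : ℝ, 0 < w ∧ ∃ F : ℂ → ℂ, MeromorphicAt F 0 ∧ ∃ A : ℝ,
      ∀ᶠ τ in codiscrete ℍ, A < τ.im → f (g • τ) = F (Function.Periodic.qParam w (τ : ℂ))

/-- The automorphic functions for a group `G` of matrices with positive determinant, that is, the
meromorphic functions on the compactified quotient of `ℍ` by `G`: functions that are meromorphic
on `ℍ`, invariant under `G` (as meromorphic functions), and meromorphic at all cusps of `G`. -/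
structure IsAutomorphicFunction (G : Subgroup (GL (Fin 2) ℝ)) (f : ℍ → ℂ) : Prop where
  meromorphic : ∀ τ : ℍ, MeromorphicAt (fun z : ℂ => f (ofComplex z)) (τ : ℂ)
  invariant : ∀ γ ∈ G, ∀ᶠ τ in codiscrete ℍ, f (γ • τ) = f τ
  meromorphic_cusps : ∀ c : OnePoint ℝ, IsCusp c G → MeromorphicAtCusp f c

/-- `h` is a Hauptmodul of `G`: a nonconstant automorphic function for `G` that generates the
field of all automorphic functions for `G` over `ℂ`, i.e. each automorphic function for `G`
is a rational function `P(h)/Q(h)` of `h`. -/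
structure IsHauptmodul (G : Subgroup (GL (Fin 2) ℝ)) (h : ℍ → ℂ) : Prop where
  automorphic : IsAutomorphicFunction G h
  nonconstant : ¬ ∃ c : ℂ, ∀ᶠ τ in codiscrete ℍ, h τ = c
  generates : ∀ f : ℍ → ℂ, IsAutomorphicFunction G f → ∃ P Q : ℂ[X],
    ∀ᶠ τ in codiscrete ℍ, Q.eval (h τ) ≠ 0 ∧ f τ = P.eval (h τ) / Q.eval (h τ)

/-- `E⁰₆(τ) = E₂(τ) - 10 E₂(2τ) + 15 E₂(3τ) - 6 E₂(6τ)`. -/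
def E06 (τ : ℍ) : ℂ :=
  EisensteinSeries.E2 τ - 10 * EisensteinSeries.E2 (dilate 2 τ)
    + 15 * EisensteinSeries.E2 (dilate 3 τ) - 6 * EisensteinSeries.E2 (dilate 6 τ)

/-- `E¹₆(τ) = 3 E₂(3τ) - 2 E₂(2τ)`. -/
def E16 (τ : ℍ) : ℂ :=
  3 * EisensteinSeries.E2 (dilate 3 τ) - 2 * EisensteinSeries.E2 (dilate 2 τ)

/-- `t₆(τ) = (η(6τ) η(τ) / (η(3τ) η(2τ)))¹²`. -/
def t6 (τ : ℍ) : ℂ :=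
  (ModularForm.eta (6 * (τ : ℂ)) * ModularForm.eta (τ : ℂ) /
    (ModularForm.eta (3 * (τ : ℂ)) * ModularForm.eta (2 * (τ : ℂ)))) ^ 12

end

/-! ### Transformation of `E₂` and `Δ` under Möbius transformations -/

/-! The group `Γ₀(6)*` has two cusps, represented by `∞` and `1/2 = W₃ ∞`, where `W₃` is an
Atkin-Lehner involution normalizing `Γ₀(6)`. The proof rests on one identity, `E⁰₆ = (5 E⁰₆ - 24
E¹₆) t₆` (`E06_eq`), whose first factor on the right is the `W₃`-conjugate of `E⁰₆`.

For the identity, `E⁰₆` is first shown to be an eta quotient up to a 24th root of unity. The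
function `(E⁰₆)²⁴ (Δ(2τ)Δ(3τ))⁵ / (Δ(τ)Δ(6τ))⁷` has weight 0, is holomorphic on `ℍ` because `Δ` has
no zeros, and has finite limits at both cusps. It is therefore constant (`etaComparison_eq`).
Conjugating by `W₃` gives the same kind of formula for `5 E⁰₆ - 24 E¹₆`. As `t₆² = Δ(τ)Δ(6τ) /
(Δ(2τ)Δ(3τ))`, the quotient of the two sides of the identity is a continuous function with 24th
power 1, hence constant, and its limit at `i∞` is 1.

The identity writes `t₆` as a quotient of two weight 2 forms with the same transformation factors.
Hence `t₆` is invariant under `Γ₀(6)*`, and `W₃` inverts it. Solving the identity for `E¹₆` yields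
the formula for `E⁰₆ / E¹₆` and the comparison of zeros.

The function `t₆` is holomorphic without zeros on `ℍ`, with a simple zero in `q` at `∞` and a simple
pole at `1/2`. An automorphic function has finitely many poles in `ℍ` modulo the group, so a
polynomial in `t₆` clears them; a power of `t₆` then clears the pole at `∞`. What remains can only
have a pole at `1/2`, and subtracting multiples of powers of `t₆` lowers its order until a constant
is left (`exists_polynomial_of_isBoundedAtImInfty`). Thus `t₆` is a Hauptmodul, and so is every
Möbius transform of it. -/

@[simp]
lemma coe_dilate (d : ℕ) [NeZero d] (τ : ℍ) : (dilate d τ : ℂ) = d * τ := rfl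

/-- The constant in the quasimodular transformation law of `E₂`. -/
noncomputable def quasiConst : ℂ := -(1 / (2 * riemannZeta 2) * (2 * Real.pi * Complex.I))

lemma exists_SL2_smul_eq {a b c d : ℤ} (hdet : a * d - b * c = 1) {τ τ' : ℍ}
    (h : (τ' : ℂ) * (c * τ + d) = a * τ + b) :
    ∃ γ : SL(2, ℤ), γ • τ = τ' ∧ γ 1 0 = c ∧ denom γ τ = c * τ + d := by
  let γ : SL(2, ℤ) := ⟨!![a, b; c, d], by rw [Matrix.det_fin_two_of, hdet]⟩
  have hden : denom γ τ = c * τ + d := by rw [ModularGroup.denom_apply]; simp [γ]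
  refine ⟨γ, ?_, rfl, hden⟩
  have hne : (c * τ + d : ℂ) ≠ 0 := hden ▸ denom_ne_zero γ τ
  ext1
  rw [UpperHalfPlane.coe_specialLinearGroup_apply]
  simp only [γ, algebraMap_int_eq, eq_intCast]
  simp only [Matrix.of_apply, Matrix.cons_val', Matrix.cons_val_zero,
    Matrix.cons_val_one, Matrix.cons_val_fin_one, Complex.ofReal_intCast]
  rw [← h, mul_div_cancel_right₀ _ hne]

/-- Stating the action as an equation in `ℂ` makes the law directly applicable to dilated points,
where the relevant integral matrix changes with the dilation. -/
lemma E2_of_moebius {a b c d : ℤ} (hdet : a * d - b * c = 1) {τ τ' : ℍ}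
    (h : (τ' : ℂ) * (c * τ + d) = a * τ + b) :
    EisensteinSeries.E2 τ' = (c * τ + d : ℂ) ^ 2 * EisensteinSeries.E2 τ
      + quasiConst * c * (c * τ + d) := by
  obtain ⟨γ, rfl, hc, hden⟩ := exists_SL2_smul_eq hdet h
  have hne : (c * τ + d : ℂ) ≠ 0 := hden ▸ denom_ne_zero γ τ
  have := congrFun (EisensteinSeries.E2_slash_action γ) τ
  rw [ModularForm.SL_slash_apply, hden] at this
  simp only [Pi.sub_apply, Pi.smul_apply, EisensteinSeries.D2, smul_eq_mul, hden, hc] at this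
  rw [zpow_neg, ← div_eq_mul_inv, div_eq_iff (zpow_ne_zero _ hne)] at this
  rw [this, quasiConst]
  field_simp
  norm_cast

open scoped ModularForm in
lemma discriminant_of_moebius {a b c d : ℤ} (hdet : a * d - b * c = 1) {τ τ' : ℍ}
    (h : (τ' : ℂ) * (c * τ + d) = a * τ + b) :
    ModularForm.discriminant τ' = (c * τ + d : ℂ) ^ 12 * ModularForm.discriminant τ := by
  obtain ⟨γ, rfl, hc, hden⟩ := exists_SL2_smul_eq hdet h
  have hne : (c * τ + d : ℂ) ≠ 0 := hden ▸ denom_ne_zero γ τ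
  have := congrFun (SlashInvariantForm.slash_action_eqn CuspForm.discriminant (γ : GL (Fin 2) ℝ)
    ⟨γ, rfl⟩) τ
  change (ModularForm.discriminant ∣[(12 : ℤ)] γ) τ = _ at this
  rw [ModularForm.SL_slash_apply, hden, zpow_neg, ← div_eq_mul_inv,
    div_eq_iff (zpow_ne_zero _ hne)] at this
  rw [this, mul_comm]
  rfl

/-- The matrix of the Atkin-Lehner involution `W₃` of level `6`. -/
noncomputable def atkinLehnerThree : GL (Fin 2) ℝ :=
  Matrix.GeneralLinearGroup.mkOfDetNeZero !![3, -2; 6, -3] (by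
    norm_num [Matrix.det_fin_two_of])

lemma det_atkinLehnerThree : atkinLehnerThree.val.det = 3 := by
  norm_num [atkinLehnerThree, Matrix.GeneralLinearGroup.mkOfDetNeZero, Matrix.det_fin_two_of]

lemma det_frickeMatrix (N : ℕ) [NeZero N] : (frickeMatrix N).val.det = N := by
  simp [frickeMatrix, Matrix.GeneralLinearGroup.mkOfDetNeZero, Matrix.det_fin_two_of]

lemma two_mul_sub_one_ne_zero (τ : ℍ) : (2 * τ - 1 : ℂ) ≠ 0 := by
  intro h
  have := congrArg Complex.im h
  simp [τ.im_ne_zero] at this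

lemma atkinLehnerThree_smul_mul (τ : ℍ) :
    ((atkinLehnerThree • τ : ℍ) : ℂ) * (3 * (2 * τ - 1)) = 3 * τ - 2 := by
  have hd : 0 < atkinLehnerThree.det.val := by
    rw [Matrix.GeneralLinearGroup.val_det_apply, det_atkinLehnerThree]; norm_num
  rw [coe_smul_of_det_pos hd, div_mul_eq_mul_div, div_eq_iff (denom_ne_zero _ τ)]
  simp only [num, denom, atkinLehnerThree, Matrix.GeneralLinearGroup.mkOfDetNeZero]
  simp
  ring

lemma frickeMatrix_smul_mul (τ : ℍ) : ((frickeMatrix 6 • τ : ℍ) : ℂ) * (6 * τ) = -1 := by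
  have hd : 0 < (frickeMatrix 6).det.val := by
    rw [Matrix.GeneralLinearGroup.val_det_apply, det_frickeMatrix]; norm_num
  rw [coe_smul_of_det_pos hd, div_mul_eq_mul_div, div_eq_iff (denom_ne_zero _ τ)]
  simp only [num, denom, frickeMatrix, Matrix.GeneralLinearGroup.mkOfDetNeZero]
  simp

/-- The image of `E⁰₆` under the Atkin-Lehner involution `W₃`. -/
noncomputable def E06Conj (τ : ℍ) : ℂ := 5 * E06 τ - 24 * E16 τ

/-- The product `Δ(τ) Δ(6τ)`. -/
noncomputable def discOuter (τ : ℍ) : ℂ :=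
  ModularForm.discriminant τ * ModularForm.discriminant (dilate 6 τ)

/-- The product `Δ(2τ) Δ(3τ)`. -/
noncomputable def discInner (τ : ℍ) : ℂ :=
  ModularForm.discriminant (dilate 2 τ) * ModularForm.discriminant (dilate 3 τ)

lemma discOuter_ne_zero (τ : ℍ) : discOuter τ ≠ 0 :=
  mul_ne_zero (ModularForm.discriminant_ne_zero _) (ModularForm.discriminant_ne_zero _)

lemma discInner_ne_zero (τ : ℍ) : discInner τ ≠ 0 :=
  mul_ne_zero (ModularForm.discriminant_ne_zero _) (ModularForm.discriminant_ne_zero _)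

/-- Dilation by `k` turns `(a, b; c, d)` into `(a, kb; c/k, d)`, still integral since `6 ∣ c` and `k
∣ 6`. The non-modular terms of `E₂` cancel because `1 - 10/2 + 15/3 - 6/6 = 0` and `3/3 - 2/2 = 0`.
-/
lemma level_six_transform_Gamma0 {γ : SL(2, ℤ)} (hγ : γ ∈ CongruenceSubgroup.Gamma0 6) (τ : ℍ) :
    E06 (γ • τ) = denom γ τ ^ 2 * E06 τ ∧ E16 (γ • τ) = denom γ τ ^ 2 * E16 τ ∧
      discOuter (γ • τ) = (denom γ τ ^ 2) ^ 12 * discOuter τ ∧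
      discInner (γ • τ) = (denom γ τ ^ 2) ^ 12 * discInner τ := by
  have hdet : γ 0 0 * γ 1 1 - γ 0 1 * γ 1 0 = 1 := by
    rw [← Matrix.det_fin_two]; exact γ.det_coe
  obtain ⟨m, hm⟩ : (6 : ℤ) ∣ γ 1 0 := by
    rw [CongruenceSubgroup.Gamma0_mem] at hγ
    exact (ZMod.intCast_zmod_eq_zero_iff_dvd _ 6).mp hγ
  have hden : denom γ τ = γ 1 0 * τ + γ 1 1 := ModularGroup.denom_apply γ τ
  have hne : denom γ τ ≠ 0 := denom_ne_zero γ τ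
  have hsm : ((γ • τ : ℍ) : ℂ) * denom γ τ = γ 0 0 * τ + γ 0 1 := by
    rw [UpperHalfPlane.coe_specialLinearGroup_apply, div_mul_eq_mul_div, div_eq_iff]
    · rw [hden]; simp
    · simpa [hden] using hne
  rw [hm] at hden hdet
  rw [hden] at *
  generalize γ 0 0 = a at *
  generalize γ 0 1 = b at *
  generalize γ 1 1 = d at *
  generalize γ • τ = τ' at *
  push_cast at *
  have k1 : (τ' : ℂ) * (((6 * m : ℤ) : ℂ) * τ + d) = a * τ + b := by push_cast; exact hsm
  have k2 : (dilate 2 τ' : ℂ) * (((3 * m : ℤ) : ℂ) * dilate 2 τ + d)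
      = a * dilate 2 τ + ((2 * b : ℤ) : ℂ) := by
    simp only [coe_dilate]; push_cast; linear_combination 2 * hsm
  have k3 : (dilate 3 τ' : ℂ) * (((2 * m : ℤ) : ℂ) * dilate 3 τ + d)
      = a * dilate 3 τ + ((3 * b : ℤ) : ℂ) := by
    simp only [coe_dilate]; push_cast; linear_combination 3 * hsm
  have k6 : (dilate 6 τ' : ℂ) * ((m : ℂ) * dilate 6 τ + d)
      = a * dilate 6 τ + ((6 * b : ℤ) : ℂ) := by
    simp only [coe_dilate]; push_cast; linear_combination 6 * hsm
  have d1 : a * d - b * (6 * m) = 1 := hdet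
  have d2 : a * d - (2 * b) * (3 * m) = 1 := by linarith
  have d3 : a * d - (3 * b) * (2 * m) = 1 := by linarith
  have d6 : a * d - (6 * b) * m = 1 := by linarith
  simp only [E06, E16, discOuter, discInner]
  rw [E2_of_moebius d1 k1, E2_of_moebius d2 k2, E2_of_moebius d3 k3, E2_of_moebius d6 k6,
    discriminant_of_moebius d1 k1, discriminant_of_moebius d2 k2, discriminant_of_moebius d3 k3,
    discriminant_of_moebius d6 k6]
  simp only [coe_dilate]
  push_cast
  refine ⟨?_, ?_, ?_, ?_⟩ <;> ring

/-- The Fricke involution sends `kτ` to `-1/((6/k)τ)`, so it swaps the dilations `1 ↔ 6` and `2 ↔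
3`. -/
lemma level_six_transform_fricke (τ : ℍ) :
    E06 (frickeMatrix 6 • τ) = -(6 * τ ^ 2 : ℂ) * E06 τ ∧
      E16 (frickeMatrix 6 • τ) = -(6 * τ ^ 2 : ℂ) * E16 τ ∧
      discOuter (frickeMatrix 6 • τ) = (6 * τ ^ 2 : ℂ) ^ 12 * discOuter τ ∧
      discInner (frickeMatrix 6 • τ) = (6 * τ ^ 2 : ℂ) ^ 12 * discInner τ := by
  have hsm := frickeMatrix_smul_mul τ
  generalize frickeMatrix 6 • τ = τ' at *
  have k1 : (τ' : ℂ) * (((1 : ℤ) : ℂ) * dilate 6 τ + ((0 : ℤ) : ℂ))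
      = ((0 : ℤ) : ℂ) * dilate 6 τ + ((-1 : ℤ) : ℂ) := by
    simp only [coe_dilate]; push_cast; linear_combination hsm
  have k2 : (dilate 2 τ' : ℂ) * (((1 : ℤ) : ℂ) * dilate 3 τ + ((0 : ℤ) : ℂ))
      = ((0 : ℤ) : ℂ) * dilate 3 τ + ((-1 : ℤ) : ℂ) := by
    simp only [coe_dilate]; push_cast; linear_combination hsm
  have k3 : (dilate 3 τ' : ℂ) * (((1 : ℤ) : ℂ) * dilate 2 τ + ((0 : ℤ) : ℂ))
      = ((0 : ℤ) : ℂ) * dilate 2 τ + ((-1 : ℤ) : ℂ) := by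
    simp only [coe_dilate]; push_cast; linear_combination hsm
  have k6 : (dilate 6 τ' : ℂ) * (((1 : ℤ) : ℂ) * τ + ((0 : ℤ) : ℂ))
      = ((0 : ℤ) : ℂ) * τ + ((-1 : ℤ) : ℂ) := by
    simp only [coe_dilate]; push_cast; linear_combination hsm
  have hd : (0 : ℤ) * 0 - (-1) * 1 = 1 := by norm_num
  simp only [E06, E16, discOuter, discInner]
  rw [E2_of_moebius hd k1, E2_of_moebius hd k2, E2_of_moebius hd k3, E2_of_moebius hd k6,
    discriminant_of_moebius hd k1, discriminant_of_moebius hd k2, discriminant_of_moebius hd k3,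
    discriminant_of_moebius hd k6]
  simp only [coe_dilate]
  push_cast
  refine ⟨?_, ?_, ?_, ?_⟩ <;> ring

/-- `W₃` swaps the dilations `1 ↔ 3` and `2 ↔ 6`, up to integral matrices of determinant 1. -/
lemma level_six_transform_atkinLehnerThree (τ : ℍ) :
    E06 (atkinLehnerThree • τ) = (3 * (2 * τ - 1) ^ 2 : ℂ) * E06Conj τ ∧
      E06Conj (atkinLehnerThree • τ) = (3 * (2 * τ - 1) ^ 2 : ℂ) * E06 τ ∧
      discOuter (atkinLehnerThree • τ) = (3 * (2 * τ - 1) ^ 2 : ℂ) ^ 12 * discInner τ ∧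
      discInner (atkinLehnerThree • τ) = (3 * (2 * τ - 1) ^ 2 : ℂ) ^ 12 * discOuter τ := by
  have hsm := atkinLehnerThree_smul_mul τ
  generalize atkinLehnerThree • τ = τ' at *
  have k1 : (τ' : ℂ) * (((2 : ℤ) : ℂ) * dilate 3 τ + ((-3 : ℤ) : ℂ))
      = ((1 : ℤ) : ℂ) * dilate 3 τ + ((-2 : ℤ) : ℂ) := by
    simp only [coe_dilate]; push_cast; linear_combination hsm
  have k2 : (dilate 2 τ' : ℂ) * (((1 : ℤ) : ℂ) * dilate 6 τ + ((-3 : ℤ) : ℂ))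
      = ((1 : ℤ) : ℂ) * dilate 6 τ + ((-4 : ℤ) : ℂ) := by
    simp only [coe_dilate]; push_cast; linear_combination 2 * hsm
  have k3 : (dilate 3 τ' : ℂ) * (((2 : ℤ) : ℂ) * τ + ((-1 : ℤ) : ℂ))
      = ((3 : ℤ) : ℂ) * τ + ((-2 : ℤ) : ℂ) := by
    simp only [coe_dilate]; push_cast; linear_combination hsm
  have k6 : (dilate 6 τ' : ℂ) * (((1 : ℤ) : ℂ) * dilate 2 τ + ((-1 : ℤ) : ℂ))
      = ((3 : ℤ) : ℂ) * dilate 2 τ + ((-4 : ℤ) : ℂ) := by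
    simp only [coe_dilate]; push_cast; linear_combination 2 * hsm
  have d1 : (1 : ℤ) * (-3) - (-2) * 2 = 1 := by norm_num
  have d2 : (1 : ℤ) * (-3) - (-4) * 1 = 1 := by norm_num
  have d3 : (3 : ℤ) * (-1) - (-2) * 2 = 1 := by norm_num
  have d6 : (3 : ℤ) * (-1) - (-4) * 1 = 1 := by norm_num
  simp only [E06Conj, E06, E16, discOuter, discInner]
  rw [E2_of_moebius d1 k1, E2_of_moebius d2 k2, E2_of_moebius d3 k3, E2_of_moebius d6 k6,
    discriminant_of_moebius d1 k1, discriminant_of_moebius d2 k2, discriminant_of_moebius d3 k3,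
    discriminant_of_moebius d6 k6]
  simp only [coe_dilate]
  push_cast
  refine ⟨?_, ?_, ?_, ?_⟩ <;> ring

/-! ### Cosets of `Γ₀(6)*` and weight zero forms -/

lemma mapGL_mem_Gamma0Star {N : ℕ} [NeZero N] {γ : SL(2, ℤ)}
    (hγ : γ ∈ CongruenceSubgroup.Gamma0 N) :
    Matrix.SpecialLinearGroup.mapGL ℝ γ ∈ Gamma0Star N :=
  Subgroup.mem_sup_left ⟨γ, hγ, rfl⟩

lemma frickeMatrix_mem_Gamma0Star (N : ℕ) [NeZero N] : frickeMatrix N ∈ Gamma0Star N :=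
  Subgroup.mem_sup_right (Subgroup.subset_closure rfl)

/-- Here `(c, d - jc)` is the bottom row of `g T⁻ʲ`; the four alternatives say that right
multiplication by the inverse of `1`, `S`, `(1, 0; 2, 1)` or `(1, 0; -3, 1)` lands in `Γ₀(6)`. -/
lemma exists_residue_six (a b c d : ZMod 6) (h : a * d - b * c = 1) :
    c = 0 ∨ ∃ j : ZMod 6, d - j * c = 0 ∨ c - 2 * (d - j * c) = 0 ∨ c + 3 * (d - j * c) = 0 := by
  revert a b c d
  decide +kernel

/-- The upper triangular matrix `(x, y; 0, z)`. -/
noncomputable def upperTriangular (x y z : ℝ) (hx : x * z ≠ 0) : GL (Fin 2) ℝ :=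
  Matrix.GeneralLinearGroup.mkOfDetNeZero !![x, y; 0, z] (by
    simpa [Matrix.det_fin_two_of] using hx)

/-- Each coset of `Γ₀(6)*` is represented by `1` or `W₃` up to an upper triangular matrix. -/
def IsCuspDecomposable (g : GL (Fin 2) ℝ) : Prop :=
  ∃ γ ∈ Gamma0Star 6, ∃ ε : GL (Fin 2) ℝ, (ε = 1 ∨ ε = atkinLehnerThree) ∧
    ∃ U : GL (Fin 2) ℝ, U 1 0 = 0 ∧ 0 < U.val.det ∧ g = γ * ε * U

lemma IsCuspDecomposable.mul_left {g δ : GL (Fin 2) ℝ} (h : IsCuspDecomposable g)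
    (hδ : δ ∈ Gamma0Star 6) : IsCuspDecomposable (δ * g) := by
  obtain ⟨γ, hγ, ε, hε, U, hU, hU', rfl⟩ := h
  exact ⟨δ * γ, mul_mem hδ hγ, ε, hε, U, hU, hU', by group⟩

lemma IsCuspDecomposable.mul_right {g V : GL (Fin 2) ℝ} (h : IsCuspDecomposable g)
    (hV : V 1 0 = 0) (hV' : 0 < V.val.det) : IsCuspDecomposable (g * V) := by
  obtain ⟨γ, hγ, ε, hε, U, hU, hU', rfl⟩ := h
  refine ⟨γ, hγ, ε, hε, U * V, ?_, ?_, by group⟩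
  · simp [Matrix.mul_apply, hU, hV]
  · rw [Units.val_mul, Matrix.det_mul]; positivity

lemma isCuspDecomposable_one : IsCuspDecomposable 1 :=
  ⟨1, one_mem _, 1, .inl rfl, 1, by simp, by simp, by simp⟩

lemma mapGL_real_apply (g : SL(2, ℤ)) (i j : Fin 2) :
    (Matrix.SpecialLinearGroup.mapGL ℝ g) i j = ((g i j : ℤ) : ℝ) := by
  simp

lemma mul_T_zpow_neg_mul_inv_apply (g r : SL(2, ℤ)) (j : ℤ) :
    (g * ModularGroup.T ^ (-j) * r⁻¹) 1 0 = g 1 0 * r 1 1 - (g 1 1 - j * g 1 0) * r 1 0 := by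
  rw [Matrix.SpecialLinearGroup.coe_mul, Matrix.SpecialLinearGroup.coe_mul,
    Matrix.SpecialLinearGroup.coe_inv, ModularGroup.coe_T_zpow, Matrix.adjugate_fin_two]
  simp [Matrix.mul_apply]
  ring

lemma isCuspDecomposable_S : IsCuspDecomposable (Matrix.SpecialLinearGroup.mapGL ℝ ModularGroup.S) := by
  refine ⟨frickeMatrix 6, frickeMatrix_mem_Gamma0Star 6, 1, .inl rfl,
    upperTriangular (1 / 6) 0 1 (by norm_num), ?_, ?_, ?_⟩
  · simp [upperTriangular, Matrix.GeneralLinearGroup.mkOfDetNeZero]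
  · simp [upperTriangular, Matrix.GeneralLinearGroup.mkOfDetNeZero]
  · ext i j
    rw [mapGL_real_apply]
    fin_cases i <;> fin_cases j <;>
    simp [upperTriangular, Matrix.GeneralLinearGroup.mkOfDetNeZero, frickeMatrix, ModularGroup.S]

/-- The matrix `(1, 0; n, 1)`. -/
def lowerUnipotent (n : ℤ) : SL(2, ℤ) := ⟨!![1, 0; n, 1], by simp [Matrix.det_fin_two_of]⟩

lemma isCuspDecomposable_lowerUnipotent_two :
    IsCuspDecomposable (Matrix.SpecialLinearGroup.mapGL ℝ (lowerUnipotent 2)) := by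
  refine ⟨1, one_mem _, atkinLehnerThree, .inr rfl,
    upperTriangular (1 / 3) (2 / 3) 1 (by norm_num), ?_, ?_, ?_⟩
  · simp [upperTriangular, Matrix.GeneralLinearGroup.mkOfDetNeZero]
  · simp [upperTriangular, Matrix.GeneralLinearGroup.mkOfDetNeZero]
  · ext i j
    rw [mapGL_real_apply]
    fin_cases i <;> fin_cases j <;>
    simp [upperTriangular, Matrix.GeneralLinearGroup.mkOfDetNeZero, atkinLehnerThree,
      lowerUnipotent] <;> norm_num

lemma isCuspDecomposable_lowerUnipotent_neg_three :
    IsCuspDecomposable (Matrix.SpecialLinearGroup.mapGL ℝ (lowerUnipotent (-3))) := by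
  refine ⟨frickeMatrix 6, frickeMatrix_mem_Gamma0Star 6, atkinLehnerThree, .inr rfl,
    upperTriangular (-1 / 6) (-1 / 6) (-1 / 3) (by norm_num), ?_, ?_, ?_⟩
  · simp [upperTriangular, Matrix.GeneralLinearGroup.mkOfDetNeZero]
  · simp [upperTriangular, Matrix.GeneralLinearGroup.mkOfDetNeZero]
    norm_num
  · ext i j
    rw [mapGL_real_apply]
    fin_cases i <;> fin_cases j <;>
    simp [upperTriangular, Matrix.GeneralLinearGroup.mkOfDetNeZero, atkinLehnerThree,
      frickeMatrix, lowerUnipotent] <;> norm_num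

/-- Write `g = γ r Tʲ` with `γ ∈ Γ₀(6)` and `r` one of four matrices, which carry `∞` to the cusps
`∞`, `0`, `1/2`, `-1/3` of `Γ₀(6)`. The Fricke involution pairs these cusps, leaving only `1` and
`W₃`. -/
lemma isCuspDecomposable_SL2Z (g : SL(2, ℤ)) :
    IsCuspDecomposable (Matrix.SpecialLinearGroup.mapGL ℝ g) := by
  have key (r : SL(2, ℤ)) (hr : IsCuspDecomposable (Matrix.SpecialLinearGroup.mapGL ℝ r)) (j : ℤ)
      (h : (((g * ModularGroup.T ^ (-j) * r⁻¹) 1 0 : ℤ) : ZMod 6) = 0) :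
      IsCuspDecomposable (Matrix.SpecialLinearGroup.mapGL ℝ g) := by
    have hT : 0 < (Matrix.SpecialLinearGroup.mapGL ℝ (ModularGroup.T ^ j)).val.det := by
      rw [Matrix.det_fin_two]
      simp only [mapGL_real_apply, ModularGroup.coe_T_zpow]
      simp
    have hmem := mapGL_mem_Gamma0Star (CongruenceSubgroup.Gamma0_mem.mpr h)
    have := (hr.mul_left hmem).mul_right
      (V := Matrix.SpecialLinearGroup.mapGL ℝ (ModularGroup.T ^ j))
      (by rw [mapGL_real_apply, ModularGroup.coe_T_zpow]; simp) hT
    rwa [← map_mul, ← map_mul, show g * ModularGroup.T ^ (-j) * r⁻¹ * r * ModularGroup.T ^ j = g by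
      group] at this
  have hdet : g 0 0 * g 1 1 - g 0 1 * g 1 0 = 1 := by
    rw [← Matrix.det_fin_two]; exact g.det_coe
  have hdet6 := congrArg (Int.cast : ℤ → ZMod 6) hdet
  push_cast at hdet6
  rcases exists_residue_six _ _ _ _ hdet6 with h | ⟨j, h | h | h⟩
  · exact key 1 (by simpa using isCuspDecomposable_one) 0 (by simpa using h)
  all_goals obtain ⟨j, rfl⟩ := ZMod.intCast_surjective j
  · refine key _ isCuspDecomposable_S j ?_
    rw [mul_T_zpow_neg_mul_inv_apply]
    simp [ModularGroup.S]
    linear_combination -h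
  · refine key _ isCuspDecomposable_lowerUnipotent_two j ?_
    rw [mul_T_zpow_neg_mul_inv_apply]
    simp [lowerUnipotent]
    linear_combination h
  · refine key _ isCuspDecomposable_lowerUnipotent_neg_three j ?_
    rw [mul_T_zpow_neg_mul_inv_apply]
    simp [lowerUnipotent]
    linear_combination h

open scoped Manifold in
/-- A holomorphic function invariant under `Γ₀(6)*` and bounded at the cusps is constant. -/
lemma exists_eq_const_of_invariant {h : ℍ → ℂ} (hd : MDiff h)
    (hinv : ∀ γ ∈ Gamma0Star 6, ∀ τ, h (γ • τ) = h τ) (hb : IsBoundedAtImInfty h)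
    (hb' : IsBoundedAtImInfty fun τ => h (atkinLehnerThree • τ)) : ∃ c, ∀ τ, h τ = c := by
  have hslash (γ : SL(2, ℤ)) :
      SlashAction.map (0 : ℤ) (Matrix.SpecialLinearGroup.mapGL ℝ γ) h = fun τ => h (γ • τ) := by
    ext τ
    change (SlashAction.map (0 : ℤ) γ h) τ = _
    rw [ModularForm.SL_slash_apply]
    simp
  let f : ModularForm ((CongruenceSubgroup.Gamma0 6).map (Matrix.SpecialLinearGroup.mapGL ℝ)) 0 :=
    { toFun := h
      slash_action_eq' := by
        rintro _ ⟨γ, hγ, rfl⟩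
        rw [hslash]
        ext τ
        exact hinv _ (mapGL_mem_Gamma0Star hγ) τ
      holo' := hd
      bdd_at_cusps' := by
        intro c hc
        rw [Subgroup.IsArithmetic.isCusp_iff_isCusp_SL2Z] at hc
        rw [OnePoint.isBoundedAt_iff_forall_SL2Z hc]
        intro g _
        obtain ⟨γ, hγ, ε, hε, U, hU, hU', hg⟩ := isCuspDecomposable_SL2Z g
        -- The factor `γ` disappears by invariance, and `U` fixes `i∞`, so only the growth of `h`
        -- and `h ∘ W₃` matters.
        have hcomp : (fun τ => h (g • τ)) = (fun τ => h (ε • τ)) ∘ fun τ => U • τ := by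
          ext τ
          change h (Matrix.SpecialLinearGroup.mapGL ℝ g • τ) = _
          rw [hg, mul_assoc, mul_smul, hinv _ hγ, mul_smul]
          rfl
        change IsBoundedAtImInfty (SlashAction.map (0 : ℤ) (Matrix.SpecialLinearGroup.mapGL ℝ g) h)
        rw [hslash, hcomp]
        have hε' : IsBoundedAtImInfty fun τ => h (ε • τ) := by
          rcases hε with rfl | rfl
          · simpa using hb
          · exact hb'
        exact hε'.comp_tendsto (tendsto_smul_atImInfty hU) }
  obtain ⟨c, hc⟩ := ModularForm.eq_const_of_weight_zero f
  exact ⟨c, fun τ => congrFun hc τ⟩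

/-! ### Behaviour at `i∞` and holomorphy -/

/-- The local parameter `q = exp (2πiτ)`. -/
noncomputable def nome (τ : ℍ) : ℂ := Function.Periodic.qParam 1 τ

lemma nome_ne_zero (τ : ℍ) : nome τ ≠ 0 := Function.Periodic.qParam_ne_zero _

lemma tendsto_nome : Tendsto nome atImInfty (𝓝 0) := qParam_tendsto_atImInfty one_pos

lemma norm_nome (τ : ℍ) : ‖nome τ‖ = Real.exp (-2 * Real.pi * τ.im) := by
  simp [nome, Function.Periodic.norm_qParam]

lemma nome_dilate (d : ℕ) [NeZero d] (τ : ℍ) : nome (dilate d τ) = nome τ ^ d := by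
  simp only [nome, Function.Periodic.qParam, coe_dilate, ← Complex.exp_nat_mul]
  congr 1
  push_cast
  ring

lemma tendsto_dilate (d : ℕ) [NeZero d] : Tendsto (dilate d) atImInfty atImInfty := by
  have hd : (0 : ℝ) < d := Nat.cast_pos.mpr (Nat.pos_of_ne_zero (NeZero.ne d))
  rw [atImInfty, tendsto_comap_iff]
  have : (im ∘ dilate d : ℍ → ℝ) = fun τ => (d : ℝ) * τ.im := by
    ext τ
    simp [← coe_im]
  rw [this]
  exact tendsto_comap.const_mul_atTop hd

lemma tendsto_E2_sub_one_div :
    Tendsto (fun τ => (EisensteinSeries.E2 τ - 1) / nome τ) atImInfty (𝓝 (-24)) := by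
  have hsum (τ : ℍ) := EisensteinSeries.hasSum_qExpansion_E2 (z := τ)
  have hper : Function.Periodic (EisensteinSeries.E2 ∘ ofComplex) (1 : ℝ) := by
    intro w
    by_cases hw : 0 < w.im
    · have hw' : 0 < (w + (1 : ℝ)).im := by simpa using hw
      rw [Function.comp_apply, Function.comp_apply, ofComplex_apply_of_im_pos hw,
        ofComplex_apply_of_im_pos hw']
      have := E2_of_moebius (a := 1) (b := 1) (c := 0) (d := 1) (by norm_num)
        (τ := ⟨w, hw⟩) (τ' := ⟨w + (1 : ℝ), hw'⟩) (by simp)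
      simpa using this
    -- Off `ℍ`, `ofComplex` takes a single default value, so periodicity is automatic there.
    · have hw' : (w + (1 : ℝ)).im ≤ 0 := by simpa using not_lt.mp hw
      rw [Function.comp_apply, Function.comp_apply,
        ofComplex_apply_eq_of_im_nonpos hw' (not_lt.mp hw)]
  have han := analyticAt_cuspFunction_zero one_pos hper E2_mdifferentiable
    EisensteinSeries.isBoundedAtImInfty_E2
  have hps := (hasFPowerSeriesOnBall_cuspFunction one_pos han (fun τ => by
    simpa only [Function.Periodic.qParam, Complex.ofReal_one, div_one] using hsum τ)).hasFPowerSeriesAt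
  -- The limit is the derivative at `q = 0` of the cusp function of `E₂`, that is, the coefficient
  -- of `q`.
  have hder := hps.hasDerivAt
  have h0 := hps.coeff_zero (fun _ => 0)
  rw [hasDerivAt_iff_tendsto_slope] at hder
  have hq : Tendsto nome atImInfty (𝓝[≠] 0) :=
    tendsto_nhdsWithin_iff.mpr ⟨tendsto_nome, .of_forall nome_ne_zero⟩
  have := hder.comp hq
  simp only [FormalMultilinearSeries.ofScalars_apply_eq] at this h0
  simp at h0
  convert this using 2 with τ
  · rw [Function.comp_apply, slope_def_field, ← h0, nome,
      eq_cuspFunction τ one_ne_zero hper, sub_zero]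
  · simp

lemma tendsto_E2_dilate (d : ℕ) [NeZero d] :
    Tendsto (fun τ => EisensteinSeries.E2 (dilate d τ)) atImInfty (𝓝 1) := by
  have h := ((tendsto_E2_sub_one_div.mul tendsto_nome).add_const 1).comp (tendsto_dilate d)
  convert h using 2 with τ
  · simp [div_mul_cancel₀ _ (nome_ne_zero _)]
  · simp

lemma tendsto_E2_dilate_sub_one_div (d : ℕ) [NeZero d] (hd : 1 < d) :
    Tendsto (fun τ => (EisensteinSeries.E2 (dilate d τ) - 1) / nome τ) atImInfty (𝓝 0) := by
  have h := (tendsto_E2_sub_one_div.comp (tendsto_dilate d)).mul (tendsto_nome.pow (d - 1))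
  convert h using 2 with τ
  · rw [Function.comp_apply, nome_dilate]
    have := nome_ne_zero τ
    obtain ⟨e, rfl⟩ := Nat.exists_eq_add_of_lt hd
    field_simp
    simp [pow_add]
    ring
  · simp [Nat.sub_ne_zero_of_lt hd]

lemma tendsto_E06_div : Tendsto (fun τ => E06 τ / nome τ) atImInfty (𝓝 (-24)) := by
  have h := ((tendsto_E2_sub_one_div.sub
    ((tendsto_E2_dilate_sub_one_div 2 (by norm_num)).const_mul 10)).add
    ((tendsto_E2_dilate_sub_one_div 3 (by norm_num)).const_mul 15)).sub
    ((tendsto_E2_dilate_sub_one_div 6 (by norm_num)).const_mul 6)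
  convert h using 2 with τ
  · rw [E06]; ring
  · simp

lemma tendsto_E06 : Tendsto E06 atImInfty (𝓝 0) := by
  have h := tendsto_E06_div.mul tendsto_nome
  convert h using 2 with τ
  · rw [div_mul_cancel₀ _ (nome_ne_zero τ)]
  · simp

lemma tendsto_E16 : Tendsto E16 atImInfty (𝓝 1) := by
  have h := ((tendsto_E2_dilate 3).const_mul 3).sub ((tendsto_E2_dilate 2).const_mul 2)
  convert h using 2 <;> norm_num [E16, E06Conj]

lemma tendsto_E06Conj : Tendsto E06Conj atImInfty (𝓝 (-24)) := by
  have h := (tendsto_E06.const_mul 5).sub (tendsto_E16.const_mul 24)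
  convert h using 2 <;> norm_num [E16, E06Conj]

lemma tendsto_discriminant_div :
    Tendsto (fun τ => ModularForm.discriminant τ / nome τ) atImInfty (𝓝 1) := by
  refine ModularForm.tendsto_atImInfty_tprod_one_sub_eta_q_pow.congr fun τ => ?_
  rw [ModularForm.discriminant_eq_q_prod, nome, mul_div_cancel_left₀]
  exact nome_ne_zero τ

lemma tendsto_discOuter_div :
    Tendsto (fun τ => discOuter τ / nome τ ^ 7) atImInfty (𝓝 1) := by
  have h := tendsto_discriminant_div.mul (tendsto_discriminant_div.comp (tendsto_dilate 6))
  convert h using 2 with τ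
  · rw [discOuter, Function.comp_apply, nome_dilate, div_mul_div_comm]; ring
  · simp

lemma tendsto_discInner_div :
    Tendsto (fun τ => discInner τ / nome τ ^ 5) atImInfty (𝓝 1) := by
  have h := (tendsto_discriminant_div.comp (tendsto_dilate 2)).mul
    (tendsto_discriminant_div.comp (tendsto_dilate 3))
  convert h using 2 with τ
  · rw [discInner, Function.comp_apply, Function.comp_apply, nome_dilate, nome_dilate,
      div_mul_div_comm]; ring
  · simp

/-- The infinite product `∏ (1 - qⁿ)`. -/
noncomputable def eulerProduct (z : ℂ) : ℂ := ∏' n, (1 - ModularForm.eta_q n z)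

lemma tendsto_eulerProduct : Tendsto (fun τ : ℍ => eulerProduct τ) atImInfty (𝓝 1) := by
  have htprod : Tendsto (fun q : ℂ => ∏' n : ℕ, (1 - q ^ (n + 1))) (𝓝 0) (𝓝 1) := by
    have := tendsto_tprod_one_add_of_dominated_convergence (𝓕 := 𝓝 0) (g := 0)
      (f := fun (q : ℂ) (n : ℕ) => -q ^ (n + 1)) (bound := fun n => (1 / 2 : ℝ) ^ (n + 1))
    simp only [Pi.zero_apply, norm_neg, norm_pow, add_zero, tprod_one] at this
    simp_rw [sub_eq_add_neg]
    refine this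
      (by simpa only [pow_succ'] using (summable_geometric_of_abs_lt_one (by norm_num)).mul_left _)
      (fun k => by simpa using ((continuous_pow (M := ℂ) (k + 1)).tendsto 0).neg) ?_
    filter_upwards [Metric.ball_mem_nhds (0 : ℂ) (by norm_num : (0 : ℝ) < 1 / 2)] with q hq k
    exact pow_le_pow_left₀ (norm_nonneg _) (mem_ball_zero_iff.mp hq).le _
  exact htprod.comp tendsto_nome

/-- The power of `q` in front of the products is `12 (6 + 1 - 3 - 2) / 24 = 1`. -/
lemma tendsto_t6_div : Tendsto (fun τ => t6 τ / nome τ) atImInfty (𝓝 1) := by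
  have h := (((tendsto_eulerProduct.comp (tendsto_dilate 6)).mul tendsto_eulerProduct).div
    ((tendsto_eulerProduct.comp (tendsto_dilate 3)).mul
      (tendsto_eulerProduct.comp (tendsto_dilate 2))) (by norm_num)).pow 12
  convert h using 2 with τ
  · simp only [Function.comp_apply, coe_dilate, t6, ModularForm.eta, eulerProduct]
    have hq : (Function.Periodic.qParam 24 (6 * τ) * Function.Periodic.qParam 24 τ /
        (Function.Periodic.qParam 24 (3 * τ) * Function.Periodic.qParam 24 (2 * τ))) ^ 12
          = nome τ := by
      simp only [nome, Function.Periodic.qParam, ← Complex.exp_add, ← Complex.exp_sub,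
        ← Complex.exp_nat_mul]
      congr 1
      push_cast
      ring
    rw [div_eq_iff (nome_ne_zero τ), ← hq, ← mul_pow]
    push_cast
    congr 1
    rw [Pi.div_apply, div_mul_div_comm]
    congr 1 <;> ring
  · simp

lemma tendsto_t6 : Tendsto t6 atImInfty (𝓝 0) := by
  have h := tendsto_t6_div.mul tendsto_nome
  convert h using 2 with τ
  · rw [div_mul_cancel₀ _ (nome_ne_zero τ)]
  · simp

lemma t6_sq (τ : ℍ) : t6 τ ^ 2 = discOuter τ / discInner τ := by
  simp only [t6, discOuter, discInner, ModularForm.discriminant, coe_dilate]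
  push_cast
  ring

lemma t6_ne_zero (τ : ℍ) : t6 τ ≠ 0 := by
  have h : t6 τ ^ 2 ≠ 0 := by
    rw [t6_sq]
    exact div_ne_zero (discOuter_ne_zero τ) (discInner_ne_zero τ)
  exact fun h0 => h (by simp [h0])

open scoped Manifold

lemma mdifferentiable_comp_dilate {f : ℍ → ℂ} (hf : MDiff f) (d : ℕ) [NeZero d] :
    MDiff fun τ => f (dilate d τ) := by
  have hd : (0 : ℝ) < d := Nat.cast_pos.mpr (Nat.pos_of_ne_zero (NeZero.ne d))
  let g := upperTriangular d 0 1 (by simpa using hd.ne')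
  have hg : 0 < g.det.val := by
    simpa [g, upperTriangular, Matrix.GeneralLinearGroup.mkOfDetNeZero,
      Matrix.det_fin_two_of] using hd
  have : (fun τ => f (dilate d τ)) = f ∘ fun τ => g • τ := by
    ext τ
    rw [Function.comp_apply]
    congr 1
    ext1
    rw [coe_smul_of_det_pos hg]
    simp [num, denom, g, upperTriangular, Matrix.GeneralLinearGroup.mkOfDetNeZero]
  rw [this]
  exact hf.comp (mdifferentiable_smul hg)

lemma mdifferentiable_E06 : MDiff E06 := by
  have h1 := E2_mdifferentiable
  exact ((h1.sub ((mdifferentiable_comp_dilate h1 2).const_smul (10 : ℂ))).add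
    ((mdifferentiable_comp_dilate h1 3).const_smul (15 : ℂ))).sub
    ((mdifferentiable_comp_dilate h1 6).const_smul (6 : ℂ))

lemma mdifferentiable_E16 : MDiff E16 := by
  have h1 := E2_mdifferentiable
  exact ((mdifferentiable_comp_dilate h1 3).const_smul (3 : ℂ)).sub
    ((mdifferentiable_comp_dilate h1 2).const_smul (2 : ℂ))

lemma mdifferentiable_E06Conj : MDiff E06Conj :=
  (mdifferentiable_E06.const_smul (5 : ℂ)).sub (mdifferentiable_E16.const_smul (24 : ℂ))

lemma mdifferentiable_discriminant : MDiff ModularForm.discriminant :=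
  CuspForm.discriminant.holo'

lemma mdifferentiable_discOuter : MDiff discOuter :=
  mdifferentiable_discriminant.mul (mdifferentiable_comp_dilate mdifferentiable_discriminant 6)

lemma mdifferentiable_discInner : MDiff discInner :=
  (mdifferentiable_comp_dilate mdifferentiable_discriminant 2).mul
    (mdifferentiable_comp_dilate mdifferentiable_discriminant 3)

lemma mdifferentiable_div {f g : ℍ → ℂ} (hf : MDiff f) (hg : MDiff g) (h : ∀ τ, g τ ≠ 0) :
    MDiff fun τ => f τ / g τ := by
  rw [mdifferentiable_iff] at *
  exact hf.div hg fun z _ => h _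

lemma mdifferentiable_eta_dilate (d : ℕ) [NeZero d] :
    MDiff fun τ : ℍ => ModularForm.eta (dilate d τ) := by
  refine mdifferentiable_comp_dilate (f := fun τ : ℍ => ModularForm.eta τ) ?_ d
  rw [mdifferentiable_iff]
  refine .congr (fun z hz => (ModularForm.differentiableAt_eta_of_mem_upperHalfPlaneSet
    hz).differentiableWithinAt) fun z hz => ?_
  simp [ofComplex_apply_of_im_pos hz]

lemma mdifferentiable_mul_pow_div {a b c d : ℍ → ℂ} (ha : MDiff a) (hb : MDiff b) (hc : MDiff c)
    (hd : MDiff d) (hc0 : ∀ τ, c τ ≠ 0) (hd0 : ∀ τ, d τ ≠ 0) (n : ℕ) :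
    MDiff fun τ => (a τ * b τ / (c τ * d τ)) ^ n :=
  (mdifferentiable_div (ha.mul hb) (hc.mul hd) fun τ => mul_ne_zero (hc0 τ) (hd0 τ)).pow n

lemma mdifferentiable_t6 : MDiff t6 := by
  have h := mdifferentiable_mul_pow_div
    (mdifferentiable_eta_dilate 6) (mdifferentiable_eta_dilate 1)
    (mdifferentiable_eta_dilate 3) (mdifferentiable_eta_dilate 2)
    (fun τ => ModularForm.eta_ne_zero (dilate 3 τ).im_pos)
    (fun τ => ModularForm.eta_ne_zero (dilate 2 τ).im_pos) 12
  simp only [coe_dilate, Nat.cast_ofNat, Nat.cast_one, one_mul] at h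
  exact h

/-! ### The identity `E⁰₆ = (5 E⁰₆ - 24 E¹₆) t₆` -/

/-- The matrices leaving `h` invariant form a subgroup, so generators suffice. -/
lemma forall_mem_Gamma0Star_smul_eq {N : ℕ} [NeZero N] {h : ℍ → ℂ}
    (h0 : ∀ γ ∈ CongruenceSubgroup.Gamma0 N, ∀ τ : ℍ, h (γ • τ) = h τ)
    (hW : ∀ τ, h (frickeMatrix N • τ) = h τ) :
    ∀ γ ∈ Gamma0Star N, ∀ τ, h (γ • τ) = h τ := by
  let H : Subgroup (GL (Fin 2) ℝ) :=
    { carrier := {γ | ∀ τ, h (γ • τ) = h τ}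
      mul_mem' := fun {a b} ha hb τ => by rw [mul_smul, ha, hb]
      one_mem' := fun τ => by rw [one_smul]
      inv_mem' := fun {a} ha τ => by rw [← ha (a⁻¹ • τ), smul_inv_smul] }
  have : Gamma0Star N ≤ H := by
    refine sup_le ?_ ?_
    · rintro _ ⟨γ, hγ, rfl⟩
      exact h0 γ hγ
    · rw [Subgroup.closure_le]
      rintro _ rfl
      exact hW
  exact this

/-- The weight zero quotient `(E⁰₆)²⁴ (Δ(2τ) Δ(3τ))⁵ / (Δ(τ) Δ(6τ))⁷`. -/
noncomputable def etaComparison (τ : ℍ) : ℂ := E06 τ ^ 24 * discInner τ ^ 5 / discOuter τ ^ 7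

/-- The factors cancel because `24 + 12 · 5 = 12 · 7`. -/
lemma etaComparison_transform {J e p r : ℂ} (hJ : J ≠ 0) (hp : p ≠ 0) :
    (J * e) ^ 24 * (J ^ 12 * r) ^ 5 / (J ^ 12 * p) ^ 7 = e ^ 24 * r ^ 5 / p ^ 7 := by
  field_simp

lemma etaComparison_smul (γ : GL (Fin 2) ℝ) (hγ : γ ∈ Gamma0Star 6) (τ : ℍ) :
    etaComparison (γ • τ) = etaComparison τ := by
  revert τ γ
  refine forall_mem_Gamma0Star_smul_eq (fun γ hγ τ => ?_) fun τ => ?_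
  · obtain ⟨h1, -, h3, h4⟩ := level_six_transform_Gamma0 hγ τ
    rw [etaComparison, h1, h3, h4, etaComparison_transform
      (pow_ne_zero _ (denom_ne_zero γ τ)) (discOuter_ne_zero τ), etaComparison]
  · obtain ⟨h1, -, h3, h4⟩ := level_six_transform_fricke τ
    -- The sign in the Fricke law of `E⁰₆` disappears in the even power 24.
    rw [etaComparison, h1, h3, h4, neg_mul, Even.neg_pow (by decide), etaComparison_transform
      (mul_ne_zero (by norm_num) (pow_ne_zero _ τ.ne_zero)) (discOuter_ne_zero τ), etaComparison]

lemma three_mul_sq_ne_zero (τ : ℍ) : (3 * (2 * τ - 1) ^ 2 : ℂ) ≠ 0 :=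
  mul_ne_zero (by norm_num) (pow_ne_zero _ (two_mul_sub_one_ne_zero τ))

lemma etaComparison_atkinLehnerThree (τ : ℍ) : etaComparison (atkinLehnerThree • τ) =
    E06Conj τ ^ 24 * discOuter τ ^ 5 / discInner τ ^ 7 := by
  obtain ⟨h1, -, h3, h4⟩ := level_six_transform_atkinLehnerThree τ
  rw [etaComparison, h1, h3, h4, etaComparison_transform (three_mul_sq_ne_zero τ)
    (discInner_ne_zero τ)]

open scoped Manifold in
lemma mdifferentiable_etaComparison : MDiff etaComparison :=
  mdifferentiable_div ((mdifferentiable_E06.pow 24).mul (mdifferentiable_discInner.pow 5))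
    (mdifferentiable_discOuter.pow 7) fun τ => pow_ne_zero _ (discOuter_ne_zero τ)

/-- The order in `q` at `i∞` is `24 · 1 + 5 · 5 - 7 · 7 = 0`. -/
lemma tendsto_etaComparison : Tendsto etaComparison atImInfty (𝓝 (24 ^ 24)) := by
  have h := ((tendsto_E06_div.pow 24).mul (tendsto_discInner_div.pow 5)).div
    (tendsto_discOuter_div.pow 7) (by norm_num)
  convert h using 2
  · ext τ
    rw [Pi.div_apply, etaComparison]
    have := nome_ne_zero τ
    have := discOuter_ne_zero τ
    field_simp
  · norm_num

/-- The conjugate of `E⁰₆` has the nonzero limit `-24`, and the discriminants contribute order `5 ·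
7 - 7 · 5 = 0`. -/
lemma tendsto_etaComparison_atkinLehnerThree :
    Tendsto (fun τ => etaComparison (atkinLehnerThree • τ)) atImInfty (𝓝 (24 ^ 24)) := by
  have h := ((tendsto_E06Conj.pow 24).mul (tendsto_discOuter_div.pow 5)).div
    (tendsto_discInner_div.pow 7) (by norm_num)
  convert h using 2 with τ
  · rw [Pi.div_apply, etaComparison_atkinLehnerThree]
    have := nome_ne_zero τ
    have := discInner_ne_zero τ
    field_simp
  · norm_num

instance atImInfty_neBot : NeBot atImInfty := by
  rw [atImInfty, comap_neBot_iff]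
  intro t ht
  obtain ⟨a, ha⟩ := mem_atTop_sets.mp ht
  exact ⟨⟨Complex.I * (max a 1 : ℝ), by simp⟩, ha _ (by simp [← coe_im])⟩

lemma etaComparison_eq (τ : ℍ) : etaComparison τ = 24 ^ 24 := by
  obtain ⟨c, hc⟩ := exists_eq_const_of_invariant mdifferentiable_etaComparison
    etaComparison_smul (tendsto_etaComparison.isBigO_one ℝ)
    (tendsto_etaComparison_atkinLehnerThree.isBigO_one ℝ)
  have h := tendsto_etaComparison
  rw [show etaComparison = fun _ => c from funext hc] at h
  rw [hc, tendsto_nhds_unique tendsto_const_nhds h]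

lemma E06_pow (τ : ℍ) : E06 τ ^ 24 = 24 ^ 24 * discOuter τ ^ 7 / discInner τ ^ 5 := by
  have h := etaComparison_eq τ
  have := discOuter_ne_zero τ
  have := discInner_ne_zero τ
  rw [etaComparison] at h
  field_simp at h ⊢
  exact h

lemma E06Conj_pow (τ : ℍ) : E06Conj τ ^ 24 = 24 ^ 24 * discInner τ ^ 7 / discOuter τ ^ 5 := by
  have h := etaComparison_eq (atkinLehnerThree • τ)
  have := discOuter_ne_zero τ
  have := discInner_ne_zero τ
  rw [etaComparison_atkinLehnerThree] at h
  field_simp at h ⊢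
  exact h

lemma E06Conj_ne_zero (τ : ℍ) : E06Conj τ ≠ 0 := by
  intro h0
  have h := E06Conj_pow τ
  rw [h0, zero_pow (by norm_num), eq_comm] at h
  exact div_ne_zero (mul_ne_zero (by norm_num) (pow_ne_zero _ (discInner_ne_zero τ)))
    (pow_ne_zero _ (discOuter_ne_zero τ)) h

lemma E06_eq (τ : ℍ) : E06 τ = E06Conj τ * t6 τ := by
  let u : ℍ → ℂ := fun τ => E06 τ / (E06Conj τ * t6 τ)
  have hne (τ) : E06Conj τ * t6 τ ≠ 0 := mul_ne_zero (E06Conj_ne_zero τ) (t6_ne_zero τ)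
  have hu : Continuous u :=
    mdifferentiable_E06.continuous.div
      (mdifferentiable_E06Conj.continuous.mul mdifferentiable_t6.continuous) hne
  have hpow (τ) : u τ ^ 24 = 1 := by
    have := discOuter_ne_zero τ
    have := discInner_ne_zero τ
    rw [div_pow, mul_pow, show t6 τ ^ 24 = (t6 τ ^ 2) ^ 12 by ring, t6_sq, E06_pow, E06Conj_pow]
    field_simp
  have hfin : {z : ℂ | z ^ 24 = 1}.Finite := by
    refine (Polynomial.finite_setOfPred_isRoot (p := (Polynomial.X ^ 24 - 1 : ℂ[X])) ?_).subset ?_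
    · exact Polynomial.X_pow_sub_C_ne_zero (by norm_num) 1
    · intro z hz
      simpa [Polynomial.IsRoot, sub_eq_zero] using hz
  -- A continuous map from the connected space `ℍ` to the finite set of 24th roots of unity is
  -- constant.
  have hconst (σ) : u σ = u τ :=
    isPreconnected_univ.constant_of_mapsTo hfin.isDiscrete hu.continuousOn
      (fun σ _ => hpow σ) (Set.mem_univ σ) (Set.mem_univ τ)
  have hlim : Tendsto u atImInfty (𝓝 1) := by
    have h := tendsto_E06_div.div (tendsto_E06Conj.mul tendsto_t6_div) (by norm_num)
    convert! h using 2
    · ext σ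
      rw [Pi.div_apply]
      have := nome_ne_zero σ
      have := hne σ
      simp only [u]
      field_simp
    · norm_num
  rw [show u = fun _ => u τ from funext hconst] at hlim
  have h1 : u τ = 1 := tendsto_nhds_unique tendsto_const_nhds hlim
  exact (div_eq_one_iff_eq (hne τ)).mp h1

lemma t6_eq_div (τ : ℍ) : t6 τ = E06 τ / E06Conj τ := by
  rw [E06_eq, mul_div_cancel_left₀ _ (E06Conj_ne_zero τ)]

lemma t6_smul (γ : GL (Fin 2) ℝ) (hγ : γ ∈ Gamma0Star 6) (τ : ℍ) : t6 (γ • τ) = t6 τ := by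
  revert τ γ
  have key {J e e' : ℂ} (hJ : J ≠ 0) :
      J * e / (5 * (J * e) - 24 * (J * e')) = e / (5 * e - 24 * e') := by
    rw [show 5 * (J * e) - 24 * (J * e') = J * (5 * e - 24 * e') by ring, mul_div_mul_left _ _ hJ]
  refine forall_mem_Gamma0Star_smul_eq (fun γ hγ τ => ?_) fun τ => ?_
  · obtain ⟨h1, h2, -⟩ := level_six_transform_Gamma0 hγ τ
    rw [t6_eq_div, E06Conj, h1, h2, key (pow_ne_zero _ (denom_ne_zero γ τ)), t6_eq_div, E06Conj]
  · obtain ⟨h1, h2, -⟩ := level_six_transform_fricke τ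
    rw [t6_eq_div, E06Conj, h1, h2, key (neg_ne_zero.mpr (mul_ne_zero (by norm_num)
      (pow_ne_zero _ τ.ne_zero))), t6_eq_div, E06Conj]

lemma t6_atkinLehnerThree_smul (τ : ℍ) : t6 (atkinLehnerThree • τ) = (t6 τ)⁻¹ := by
  obtain ⟨h1, h2, -⟩ := level_six_transform_atkinLehnerThree τ
  rw [t6_eq_div, h1, h2, mul_div_mul_left _ _ (three_mul_sq_ne_zero τ), t6_eq_div, inv_div]

lemma E16_eq (τ : ℍ) : E16 τ = -(1 / 24) * E06Conj τ * (1 - 5 * t6 τ) := by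
  have h := E06_eq τ
  have h' : E06Conj τ = 5 * E06 τ - 24 * E16 τ := rfl
  linear_combination (1 / 24) * h' + (5 / 24) * h

lemma E16_eq_zero_iff (τ : ℍ) : E16 τ = 0 ↔ 1 - 5 * t6 τ = 0 := by
  rw [E16_eq, mul_eq_zero, or_iff_right]
  exact mul_ne_zero (by norm_num) (E06Conj_ne_zero τ)

/-- Where the denominators vanish, they do so together and both sides are `0` by the convention for
division. -/
lemma E06_div_E16 (τ : ℍ) : E06 τ / E16 τ = -24 * t6 τ / (1 - 5 * t6 τ) := by
  rw [E16_eq, E06_eq, mul_assoc, mul_left_comm, mul_div_mul_left _ _ (E06Conj_ne_zero τ)]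
  rw [div_mul_eq_div_div]
  congr 1
  ring

/-! ### The cusps of `Γ₀(6)*` and the automorphy of `t₆` -/

/-- Rationality of the entries makes the fixed points of parabolic elements rational or `∞`, so the
cusps are those of `SL(2, ℤ)`. -/
lemma exists_rat_of_mem_Gamma0Star {N : ℕ} [NeZero N] {γ : GL (Fin 2) ℝ} (hγ : γ ∈ Gamma0Star N) :
    ∃ δ : GL (Fin 2) ℚ, γ = δ.map (Rat.castHom ℝ) := by
  have : Gamma0Star N ≤ (Matrix.GeneralLinearGroup.map (n := Fin 2) (Rat.castHom ℝ)).range := by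
    refine sup_le ?_ ?_
    · rintro _ ⟨g, -, rfl⟩
      refine ⟨Matrix.SpecialLinearGroup.mapGL ℚ g, ?_⟩
      ext i j
      simp
    · rw [Subgroup.closure_le]
      rintro _ rfl
      refine ⟨Matrix.GeneralLinearGroup.mkOfDetNeZero !![0, -1; (N : ℚ), 0] (by
        simp [Matrix.det_fin_two_of, NeZero.ne N]), ?_⟩
      ext i j
      fin_cases i <;> fin_cases j <;>
      simp [frickeMatrix, Matrix.GeneralLinearGroup.mkOfDetNeZero]
  obtain ⟨δ, hδ⟩ := this hγ
  exact ⟨δ, hδ.symm⟩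

lemma IsCusp.exists_SL2Z_of_Gamma0Star {N : ℕ} [NeZero N] {c : OnePoint ℝ}
    (hc : IsCusp c (Gamma0Star N)) :
    ∃ g : SL(2, ℤ), c = Matrix.SpecialLinearGroup.mapGL ℝ g • OnePoint.infty := by
  rw [← isCusp_SL2Z_iff', isCusp_SL2Z_iff]
  obtain ⟨γ, hγ, hgp, hgc⟩ := hc
  obtain ⟨δ, rfl⟩ := exists_rat_of_mem_Gamma0Star hγ
  rw [hgp.smul_eq_self_iff.mp hgc]
  exact ⟨δ.parabolicFixedPoint, by
    simp [Matrix.GeneralLinearGroup.parabolicFixedPoint, apply_ite]⟩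

lemma isCusp_Gamma0Star {N : ℕ} [NeZero N] (g : SL(2, ℤ)) :
    IsCusp (Matrix.SpecialLinearGroup.mapGL ℝ g • OnePoint.infty) (Gamma0Star N) := by
  have h : IsCusp (Matrix.SpecialLinearGroup.mapGL ℝ g • OnePoint.infty)
      ((CongruenceSubgroup.Gamma0 N).map (Matrix.SpecialLinearGroup.mapGL ℝ)) := by
    rw [Subgroup.IsArithmetic.isCusp_iff_isCusp_SL2Z, isCusp_SL2Z_iff']
    exact ⟨g, rfl⟩
  exact h.mono le_sup_left

lemma exists_affine_of_upperTriangular {U : GL (Fin 2) ℝ} (hU : U 1 0 = 0) (hU' : 0 < U.val.det) :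
    ∃ a b : ℝ, 0 < a ∧ ∀ τ : ℍ, ((U • τ : ℍ) : ℂ) = a * τ + b := by
  have hdet : 0 < U 0 0 * U 1 1 := by simpa [Matrix.det_fin_two, hU] using hU'
  have h11 : U 1 1 ≠ 0 := (mul_ne_zero_iff.mp hdet.ne').2
  refine ⟨U 0 0 / U 1 1, U 0 1 / U 1 1, ?_, fun τ => ?_⟩
  · rw [show U 0 0 / U 1 1 = U 0 0 * U 1 1 / U 1 1 ^ 2 by field_simp]
    positivity
  · rw [coe_smul_of_det_pos hU']
    have : ((U 1 1 : ℝ) : ℂ) ≠ 0 := by exact_mod_cast h11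
    simp only [num, denom, hU]
    push_cast
    rw [zero_mul, zero_add]
    field_simp

lemma nome_of_coe_eq {a b : ℝ} (ha : 0 < a) {τ τ' : ℍ} (h : (τ' : ℂ) = a * τ + b) :
    nome τ' = Complex.exp (2 * Real.pi * Complex.I * b) * Function.Periodic.qParam a⁻¹ τ := by
  have : (a : ℂ) ≠ 0 := by exact_mod_cast ha.ne'
  simp only [nome, Function.Periodic.qParam, h, ← Complex.exp_add]
  congr 1
  push_cast
  field_simp
  ring

lemma SL2R_smul_eq (g : SL(2, ℝ)) (τ : ℍ) : g • τ = (g : GL (Fin 2) ℝ) • τ := rfl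

lemma periodic_comp_ofComplex_of_T {f : ℍ → ℂ}
    (hf : ∀ τ : ℍ, f (ModularGroup.T • τ) = f τ) : Function.Periodic (f ∘ ofComplex) (1 : ℝ) := by
  intro w
  by_cases hw : 0 < w.im
  · have hw' : 0 < (w + (1 : ℝ)).im := by simpa using hw
    rw [Function.comp_apply, Function.comp_apply, ofComplex_apply_of_im_pos hw,
      ofComplex_apply_of_im_pos hw', ← hf ⟨w, hw⟩, modular_T_smul]
    congr 1
    ext1
    simp [add_comm]
  · have hw' : (w + (1 : ℝ)).im ≤ 0 := by simpa using not_lt.mp hw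
    rw [Function.comp_apply, Function.comp_apply,
      ofComplex_apply_eq_of_im_nonpos hw' (not_lt.mp hw)]

lemma T_mem_Gamma0 (N : ℕ) : ModularGroup.T ∈ CongruenceSubgroup.Gamma0 N := by
  rw [CongruenceSubgroup.Gamma0_mem, ModularGroup.coe_T]
  simp

lemma smul_T_of_Gamma0Star {N : ℕ} [NeZero N] {f : ℍ → ℂ}
    (hf : ∀ γ ∈ Gamma0Star N, ∀ τ, f (γ • τ) = f τ) (τ : ℍ) : f (ModularGroup.T • τ) = f τ :=
  hf _ (mapGL_mem_Gamma0Star (T_mem_Gamma0 N)) τ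

/-- The expansion of `t₆` in terms of `q`. -/
lemma exists_analyticAt_t6 : ∃ F : ℂ → ℂ, AnalyticAt ℂ F 0 ∧ ∀ τ, t6 τ = F (nome τ) := by
  have hper := periodic_comp_ofComplex_of_T (smul_T_of_Gamma0Star t6_smul)
  exact ⟨cuspFunction 1 t6, analyticAt_cuspFunction_zero one_pos hper mdifferentiable_t6
    (tendsto_t6.isBigO_one ℝ), fun τ => (eq_cuspFunction τ one_ne_zero hper).symm⟩

/-- Any `g` with `g ∞ = c` has the form `γ ε (UV)` with `UV` acting as `τ ↦ aτ + b`. This only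
rescales the parameter and changes the width to `1/a`; `ε = W₃` replaces the expansion by its
inverse. -/
lemma meromorphicAtCusp_t6 {c : OnePoint ℝ} (hc : IsCusp c (Gamma0Star 6)) :
    MeromorphicAtCusp t6 c := by
  intro g hg
  obtain ⟨g₀, rfl⟩ := hc.exists_SL2Z_of_Gamma0Star
  obtain ⟨γ, hγ, ε, hε, U, hU, hU', hg₀⟩ := isCuspDecomposable_SL2Z g₀
  have hV : ((Matrix.SpecialLinearGroup.mapGL ℝ g₀)⁻¹ * (g : GL (Fin 2) ℝ)) •
      (OnePoint.infty : OnePoint ℝ) = OnePoint.infty := by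
    rw [mul_smul, hg, inv_smul_smul]
  rw [OnePoint.smul_infty_eq_self_iff] at hV
  set V := (Matrix.SpecialLinearGroup.mapGL ℝ g₀)⁻¹ * (g : GL (Fin 2) ℝ) with hVdef
  have hV' : 0 < V.val.det := by
    rw [← Matrix.GeneralLinearGroup.val_det_apply, hVdef, map_mul, map_inv]
    simp
  have hUV : (U * V) 1 0 = 0 := by simp [Matrix.mul_apply, hU, hV]
  have hUV' : 0 < (U * V).val.det := by
    rw [Units.val_mul, Matrix.det_mul]; positivity
  obtain ⟨a, b, ha, hab⟩ := exists_affine_of_upperTriangular hUV hUV'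
  have hgV : (g : GL (Fin 2) ℝ) = γ * (ε * (U * V)) := by
    rw [← mul_assoc, ← mul_assoc, ← hg₀, hVdef, mul_inv_cancel_left]
  obtain ⟨F, hF, hFt⟩ := exists_analyticAt_t6
  let k := Complex.exp (2 * Real.pi * Complex.I * b)
  have hFk : MeromorphicAt (fun q => F (k * q)) 0 := by
    have : AnalyticAt ℂ (fun q : ℂ => F (k * q)) 0 := by
      refine AnalyticAt.fun_comp (g := F) (f := fun q => k * q) ?_ (by fun_prop)
      simpa using hF
    exact this.meromorphicAt
  have hval (τ : ℍ) : t6 (g • τ) = t6 (ε • ((U * V) • τ)) := by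
    rw [SL2R_smul_eq, hgV, mul_smul, t6_smul _ hγ, mul_smul]
  have hexp (τ : ℍ) : t6 ((U * V) • τ) = F (k * Function.Periodic.qParam a⁻¹ τ) := by
    rw [hFt, nome_of_coe_eq ha (hab τ)]
  refine ⟨a⁻¹, inv_pos.mpr ha, ?_⟩
  rcases hε with rfl | rfl
  · refine ⟨_, hFk, 0, .of_forall fun τ _ => ?_⟩
    rw [hval, one_smul, hexp]
  · refine ⟨_, hFk.inv, 0, .of_forall fun τ _ => ?_⟩
    rw [hval, t6_atkinLehnerThree_smul, hexp]
    rfl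

open scoped Manifold in
lemma analyticAt_comp_ofComplex {f : ℍ → ℂ} (hf : MDiff f) (τ : ℍ) :
    AnalyticAt ℂ (fun z => f (ofComplex z)) τ :=
  (UpperHalfPlane.mdifferentiable_iff.mp hf).analyticAt
    (isOpen_upperHalfPlaneSet.mem_nhds τ.im_pos)

lemma isAutomorphicFunction_t6 : IsAutomorphicFunction (Gamma0Star 6) t6 where
  meromorphic τ := (analyticAt_comp_ofComplex mdifferentiable_t6 τ).meromorphicAt
  invariant γ hγ := .of_forall (t6_smul γ hγ)
  meromorphic_cusps _ hc := meromorphicAtCusp_t6 hc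

/-! ### Functions off closed discrete subsets of `ℍ` -/

section Codiscrete

open scoped Manifold

lemma eventually_codiscrete_iff {X : Type*} [TopologicalSpace X] {p : X → Prop} :
    (∀ᶠ x in codiscrete X, p x) ↔ ∀ x, ∀ᶠ y in 𝓝[≠] x, p y := by
  simp only [Filter.Eventually, mem_codiscrete, disjoint_principal_right, compl_compl]

lemma tendsto_coe_nhdsNE (τ : ℍ) : Tendsto ((↑) : ℍ → ℂ) (𝓝[≠] τ) (𝓝[≠] (τ : ℂ)) := by
  refine tendsto_nhdsWithin_iff.mpr ⟨continuous_coe.continuousAt.mono_left nhdsWithin_le_nhds, ?_⟩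
  filter_upwards [self_mem_nhdsWithin] with σ hσ h
  exact hσ (UpperHalfPlane.ext h)

lemma tendsto_ofComplex_nhdsNE (τ : ℍ) : Tendsto ofComplex (𝓝[≠] (τ : ℂ)) (𝓝[≠] τ) := by
  refine tendsto_nhdsWithin_iff.mpr ⟨?_, ?_⟩
  · have h := (mdifferentiableAt_ofComplex τ.im_pos).continuousAt
    rw [ContinuousAt, ofComplex_apply] at h
    exact h.mono_left nhdsWithin_le_nhds
  · filter_upwards [self_mem_nhdsWithin, nhdsWithin_le_nhds
      (isOpen_upperHalfPlaneSet.mem_nhds τ.im_pos)] with z hz hz' h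
    apply hz
    rw [ofComplex_apply_of_im_pos hz'] at h
    exact congrArg UpperHalfPlane.coe h

lemma tendsto_smul_nhdsNE (M : GL (Fin 2) ℝ) (τ : ℍ) :
    Tendsto (fun σ : ℍ => M • σ) (𝓝[≠] τ) (𝓝[≠] (M • τ)) := by
  refine tendsto_nhdsWithin_iff.mpr
    ⟨(continuous_const_smul M).continuousAt.mono_left nhdsWithin_le_nhds, ?_⟩
  filter_upwards [self_mem_nhdsWithin] with σ hσ h
  exact hσ (smul_left_cancel M h)

lemma eventually_codiscrete_smul {p : ℍ → Prop} (h : ∀ᶠ τ in codiscrete ℍ, p τ)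
    (M : GL (Fin 2) ℝ) : ∀ᶠ τ in codiscrete ℍ, p (M • τ) := by
  rw [eventually_codiscrete_iff] at *
  exact fun τ => (tendsto_smul_nhdsNE M τ).eventually (h _)

lemma eq_of_eventually_codiscrete {u v : ℍ → ℂ} (h : ∀ᶠ τ in codiscrete ℍ, u τ = v τ) {τ : ℍ}
    (hu : ContinuousAt u τ) (hv : ContinuousAt v τ) : u τ = v τ :=
  tendsto_nhds_unique_of_eventuallyEq (hu.mono_left nhdsWithin_le_nhds)
    (hv.mono_left nhdsWithin_le_nhds) (eventually_codiscrete_iff.mp h τ)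

/-- The order of a function on `ℍ` at a point. -/
noncomputable def orderAt (f : ℍ → ℂ) (τ : ℍ) : WithTop ℤ :=
  meromorphicOrderAt (fun z : ℂ => f (ofComplex z)) τ

lemma orderAt_congr {f g : ℍ → ℂ} {τ : ℍ} (h : ∀ᶠ σ in 𝓝[≠] τ, f σ = g σ) :
    orderAt f τ = orderAt g τ :=
  meromorphicOrderAt_congr ((tendsto_ofComplex_nhdsNE τ).eventually h)

lemma orderAt_smul {f : ℍ → ℂ} {M : GL (Fin 2) ℝ} (hM : 0 < M.val.det) (τ : ℍ) :
    orderAt (fun σ => f (M • σ)) τ = orderAt f (M • τ) :=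
  meromorphicOrderAt_comp_smul hM

lemma meromorphicAt_comp_smul {f : ℍ → ℂ}
    (hf : ∀ τ : ℍ, MeromorphicAt (fun z : ℂ => f (ofComplex z)) τ)
    {M : GL (Fin 2) ℝ} (hM : 0 < M.val.det) (τ : ℍ) :
    MeromorphicAt (fun z : ℂ => f (M • ofComplex z)) τ := by
  have h := (hf (M • τ))
  have h2 : MeromorphicAt (fun z : ℂ => f (ofComplex z))
      ((fun z : ℂ => ((M • ofComplex z : ℍ) : ℂ)) τ) := by
    simpa using h
  have ha := UpperHalfPlane.analyticAt_smul hM τ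
  have := MeromorphicAt.comp_analyticAt (g := fun z : ℂ => ((M • ofComplex z : ℍ) : ℂ)) h2 ha
  simpa [Function.comp_def] using this

/-- A meromorphic function on `ℍ` without poles agrees with a holomorphic function. -/
lemma exists_mdifferentiable_of_orderAt_nonneg {f : ℍ → ℂ}
    (hf : ∀ τ : ℍ, MeromorphicAt (fun z : ℂ => f (ofComplex z)) τ)
    (hord : ∀ τ, 0 ≤ orderAt f τ) :
    ∃ h : ℍ → ℂ, MDiff h ∧ ∀ᶠ τ in codiscrete ℍ, f τ = h τ := by
  have hmer : MeromorphicOn (fun z : ℂ => f (ofComplex z)) upperHalfPlaneSet :=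
    fun z hz => hf ⟨z, hz⟩
  let N := toMeromorphicNFOn (fun z : ℂ => f (ofComplex z)) upperHalfPlaneSet
  refine ⟨fun τ => N τ, ?_, ?_⟩
  · rw [UpperHalfPlane.mdifferentiable_iff]
    intro z hz
    have hNF : MeromorphicNFAt N z :=
      meromorphicNFOn_toMeromorphicNFOn (fun z : ℂ => f (ofComplex z)) upperHalfPlaneSet hz
    have han : AnalyticAt ℂ N z := by
      rw [← hNF.meromorphicOrderAt_nonneg_iff_analyticAt, meromorphicOrderAt_toMeromorphicNFOn hmer hz]
      exact hord ⟨z, hz⟩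
    refine (han.differentiableAt.congr_of_eventuallyEq ?_).differentiableWithinAt
    filter_upwards [isOpen_upperHalfPlaneSet.mem_nhds hz] with w hw
    rw [Function.comp_apply, ofComplex_apply_of_im_pos hw]
  · rw [eventually_codiscrete_iff]
    intro τ
    have := (tendsto_coe_nhdsNE τ).eventually (hmer.toMeromorphicNFOn_eq_self_on_nhdsNE τ.im_pos)
    filter_upwards [this] with σ hσ
    rw [show N σ = f (ofComplex σ) from hσ, ofComplex_apply]

/-- Meromorphy at a cusp, in terms of matrices of positive determinant. -/
lemma MeromorphicAtCusp.exists_expansion {f : ℍ → ℂ} {M : GL (Fin 2) ℝ}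
    (hf : MeromorphicAtCusp f (M • OnePoint.infty)) (hM : 0 < M.val.det) :
    ∃ w : ℝ, 0 < w ∧ ∃ F : ℂ → ℂ, MeromorphicAt F 0 ∧ ∃ A : ℝ,
      ∀ᶠ τ in codiscrete ℍ, A < τ.im → f (M • τ) = F (Function.Periodic.qParam w (τ : ℂ)) := by
  have hs : √M.val.det ≠ 0 := (Real.sqrt_pos.mpr hM).ne'
  -- Scaling `M` to determinant 1 does not change its action.
  let g : SL(2, ℝ) := ⟨(√M.val.det)⁻¹ • M.val, by
    rw [Matrix.det_smul, Fintype.card_fin, inv_pow, Real.sq_sqrt hM.le, inv_mul_cancel₀ hM.ne']⟩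
  have hgM : M = Matrix.GeneralLinearGroup.scalar (Fin 2) (Units.mk0 _ hs) * (g : GL (Fin 2) ℝ) := by
    ext i j
    simp [Matrix.GeneralLinearGroup.scalar]
    change _ = √M.val.det * ((√M.val.det)⁻¹ * M i j)
    rw [mul_inv_cancel_left₀ hs]
  have hg : (g : GL (Fin 2) ℝ) • (OnePoint.infty : OnePoint ℝ) = M • OnePoint.infty := by
    rw [OnePoint.smul_infty_eq_ite, OnePoint.smul_infty_eq_ite]
    simp only [g, Matrix.SpecialLinearGroup.toGL]
    simp [hs, mul_div_mul_left]
  obtain ⟨w, hw, F, hF, A, h⟩ := hf g hg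
  refine ⟨w, hw, F, hF, A, ?_⟩
  filter_upwards [h] with τ hτ hA
  rw [← hτ hA, SL2R_smul_eq, hgM, mul_smul, glScalar_smul]

end Codiscrete

/-! ### Removing the poles in `ℍ` of an automorphic function -/

section Poles

open scoped Manifold

lemma eventually_atImInfty_of_nhdsNE {w : ℝ} (hw : 0 < w) {p : ℂ → Prop}
    (hp : ∀ᶠ q in 𝓝[≠] (0 : ℂ), p q) :
    ∀ᶠ τ : ℍ in atImInfty, p (Function.Periodic.qParam w τ) :=
  ((Function.Periodic.qParam_tendsto hw).comp tendsto_coe_atImInfty).eventually hp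

/-- A function meromorphic at `0` is analytic on a punctured neighbourhood of `0`, so poles cannot
accumulate at the cusp. -/
lemma exists_forall_orderAt_nonneg {f : ℍ → ℂ} {w : ℝ} (hw : 0 < w) {F : ℂ → ℂ}
    (hF : MeromorphicAt F 0) {A : ℝ}
    (h : ∀ᶠ τ in codiscrete ℍ, A < τ.im → f τ = F (Function.Periodic.qParam w (τ : ℂ))) :
    ∃ B : ℝ, ∀ τ : ℍ, B ≤ τ.im → 0 ≤ orderAt f τ := by
  obtain ⟨B, hB⟩ := (atImInfty_mem _).mp (eventually_atImInfty_of_nhdsNE hw hF.eventually_analyticAt)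
  refine ⟨max B (A + 1), fun τ hτ => ?_⟩
  have hA : A < τ.im := by linarith [le_max_right B (A + 1)]
  have han : AnalyticAt ℂ F (Function.Periodic.qParam w τ) := hB τ ((le_max_left _ _).trans hτ)
  have hq : AnalyticAt ℂ (fun z : ℂ => F (Function.Periodic.qParam w z)) τ :=
    AnalyticAt.fun_comp han
      (Function.Periodic.differentiable_qParam.analyticAt (τ : ℂ))
  have heq : (fun z : ℂ => f (ofComplex z)) =ᶠ[𝓝[≠] (τ : ℂ)]
      fun z => F (Function.Periodic.qParam w z) := by
    have hA' : ∀ᶠ σ : ℍ in 𝓝[≠] τ, A < σ.im :=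
      nhdsWithin_le_nhds (continuous_im.continuousAt.eventually (lt_mem_nhds hA))
    filter_upwards [(tendsto_ofComplex_nhdsNE τ).eventually
      ((eventually_codiscrete_iff.mp h τ).and hA'), nhdsWithin_le_nhds
      (isOpen_upperHalfPlaneSet.mem_nhds τ.im_pos)] with z hz hz'
    rw [hz.1 hz.2, ofComplex_apply_of_im_pos hz']
  rw [orderAt, meromorphicOrderAt_congr heq]
  exact hq.meromorphicOrderAt_nonneg

lemma mapGL_det_pos (g : SL(2, ℤ)) : 0 < (Matrix.SpecialLinearGroup.mapGL ℝ g).val.det := by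
  rw [← Matrix.GeneralLinearGroup.val_det_apply]
  simp

variable {N : ℕ} [NeZero N] {f : ℍ → ℂ}

/-- The expansion at the cusp excludes poles of large height; the rest of the fundamental domain is
compact. -/
lemma IsAutomorphicFunction.finite_poles_fd (hf : IsAutomorphicFunction (Gamma0Star N) f)
    (g : SL(2, ℤ)) :
    {τ : ℍ | τ ∈ ModularGroup.fd ∧
      orderAt f (Matrix.SpecialLinearGroup.mapGL ℝ g • τ) < 0}.Finite := by
  have hg := mapGL_det_pos g
  obtain ⟨w, hw, F, hF, A, h⟩ :=
    (hf.meromorphic_cusps _ (isCusp_Gamma0Star g)).exists_expansion hg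
  obtain ⟨B, hB⟩ := exists_forall_orderAt_nonneg hw hF h
  have hcomp := (ModularGroup.isCompact_truncatedFundamentalDomain B).image continuous_coe
  have hmer : MeromorphicOn
      (fun z : ℂ => f (Matrix.SpecialLinearGroup.mapGL ℝ g • ofComplex z))
      ((↑) '' ModularGroup.truncatedFundamentalDomain B) := by
    rintro _ ⟨τ, -, rfl⟩
    exact meromorphicAt_comp_smul hf.meromorphic hg τ
  have hfin := IsCompact.finite_sdiff_of_mem_codiscreteWithin hcomp hmer.analyticAt_mem_codiscreteWithin
  refine (hfin.preimage (f := ((↑) : ℍ → ℂ)) (fun _ _ _ _ h => UpperHalfPlane.ext h)).subset ?_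
  rintro τ ⟨hτ, hord⟩
  rw [← orderAt_smul hg] at hord
  refine ⟨⟨τ, ⟨hτ, ?_⟩, rfl⟩, fun han => ?_⟩
  · by_contra hlt
    exact absurd (hB τ (not_le.mp hlt).le) (not_le.mpr hord)
  · exact absurd (AnalyticAt.meromorphicOrderAt_nonneg han) (not_le.mpr hord)

/-- Modulo `Γ₀(N)`, an automorphic function has finitely many poles in `ℍ`. -/
lemma IsAutomorphicFunction.exists_finite_poles (hf : IsAutomorphicFunction (Gamma0Star N) f) :
    ∃ S : Finset ℍ, ∀ τ, orderAt f τ < 0 →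
      ∃ s ∈ S, ∃ γ ∈ CongruenceSubgroup.Gamma0 N,
        τ = Matrix.SpecialLinearGroup.mapGL ℝ γ • s := by
  let Q := SL(2, ℤ) ⧸ CongruenceSubgroup.Gamma0 N
  -- The translates of `fd` by inverses of left coset representatives cover `ℍ` modulo `Γ₀(N)`.
  let r (q : Q) : SL(2, ℤ) := q.out⁻¹
  have hfin : (⋃ q : Q, (fun τ : ℍ => Matrix.SpecialLinearGroup.mapGL ℝ (r q) • τ) ''
      {τ : ℍ | τ ∈ ModularGroup.fd ∧
        orderAt f (Matrix.SpecialLinearGroup.mapGL ℝ (r q) • τ) < 0}).Finite :=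
    Set.finite_iUnion fun q => (hf.finite_poles_fd (r q)).image _
  refine ⟨hfin.toFinset, fun τ hτ => ?_⟩
  obtain ⟨g, hg⟩ := ModularGroup.exists_smul_mem_fd τ
  let q : Q := (g : Q)
  obtain ⟨δ, hδ⟩ := QuotientGroup.mk_out_eq_mul (CongruenceSubgroup.Gamma0 N) g
  have hr : r q = (δ : SL(2, ℤ))⁻¹ * g⁻¹ := by
    change (Quotient.out (g : Q))⁻¹ = _
    rw [hδ, mul_inv_rev]
  have hrel : Matrix.SpecialLinearGroup.mapGL ℝ (r q) • (g • τ) =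
      Matrix.SpecialLinearGroup.mapGL ℝ (δ : SL(2, ℤ))⁻¹ • τ := by
    rw [ModularGroup.sl_moeb, smul_smul]
    change (_ * Matrix.SpecialLinearGroup.mapGL ℝ g) • τ = _
    rw [← map_mul, hr, inv_mul_cancel_right]
  have hmem : (δ : SL(2, ℤ))⁻¹ ∈ CongruenceSubgroup.Gamma0 N := inv_mem δ.2
  refine ⟨Matrix.SpecialLinearGroup.mapGL ℝ (r q) • (g • τ), ?_, δ, δ.2, ?_⟩
  · rw [Set.Finite.mem_toFinset, Set.mem_iUnion]
    refine ⟨q, g • τ, ⟨hg, ?_⟩, rfl⟩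
    rw [hrel, ← orderAt_smul (mapGL_det_pos _)]
    rwa [orderAt_congr (eventually_codiscrete_iff.mp
      (hf.invariant _ (mapGL_mem_Gamma0Star hmem)) τ)]
  · rw [hrel, smul_smul, ← map_mul, mul_inv_cancel, map_one, one_smul]

/-- Multiplication by a power of `t - t(τ)` removes a pole at `τ`. -/
lemma exists_orderAt_mul_pow_nonneg {t : ℍ → ℂ} (ht : MDiff t) {τ : ℍ}
    (hf : MeromorphicAt (fun z : ℂ => f (ofComplex z)) τ) :
    ∃ n : ℕ, 0 ≤ orderAt (fun σ => (t σ - t τ) ^ n * f σ) τ := by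
  obtain ⟨n, hn⟩ := hf
  have han : AnalyticAt ℂ (fun z : ℂ => t (ofComplex z) - t τ) τ :=
    (analyticAt_comp_ofComplex ht τ).sub analyticAt_const
  have hz : (1 : ℕ∞) ≤ analyticOrderAt (fun z : ℂ => t (ofComplex z) - t τ) τ := by
    rw [Order.one_le_iff_ne_zero, han.analyticOrderAt_ne_zero]
    simp
  obtain ⟨g, hg, hgeq⟩ := (natCast_le_analyticOrderAt (n := 1) han).mp (by exact_mod_cast hz)
  refine ⟨n, ?_⟩
  have heq : (fun z : ℂ => (t (ofComplex z) - t τ) ^ n * f (ofComplex z)) =ᶠ[𝓝[≠] (τ : ℂ)]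
      fun z => g z ^ n * ((z - τ) ^ n • f (ofComplex z)) := by
    filter_upwards [nhdsWithin_le_nhds hgeq] with z hz
    rw [hz, pow_one, smul_eq_mul, mul_pow, smul_eq_mul]
    ring
  rw [orderAt, meromorphicOrderAt_congr heq]
  exact ((hg.pow n).mul hn).meromorphicOrderAt_nonneg

lemma mdifferentiable_eval {t : ℍ → ℂ} (ht : MDiff t) (Q : ℂ[X]) :
    MDiff fun τ => Q.eval (t τ) := by
  rw [UpperHalfPlane.mdifferentiable_iff] at *
  exact Q.differentiable.comp_differentiableOn ht

lemma orderAt_mul_nonneg {u v : ℍ → ℂ} {τ : ℍ} (hu : MDiff u)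
    (hv : MeromorphicAt (fun z : ℂ => v (ofComplex z)) τ) (h : 0 ≤ orderAt v τ) :
    0 ≤ orderAt (fun σ => u σ * v σ) τ := by
  have han := analyticAt_comp_ofComplex hu τ
  have : orderAt (fun σ => u σ * v σ) τ = orderAt u τ + orderAt v τ :=
    meromorphicOrderAt_mul han.meromorphicAt hv
  rw [this]
  exact add_nonneg han.meromorphicOrderAt_nonneg h

/-- Multiplication by a polynomial in an invariant holomorphic function `t` removes the poles in
`ℍ` of an automorphic function. -/
lemma IsAutomorphicFunction.exists_polynomial_orderAt_nonneg
    (hf : IsAutomorphicFunction (Gamma0Star N) f) {t : ℍ → ℂ} (ht : MDiff t)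
    (hinv : ∀ γ ∈ Gamma0Star N, ∀ τ, t (γ • τ) = t τ) :
    ∃ Q : ℂ[X], Q ≠ 0 ∧ ∀ τ, 0 ≤ orderAt (fun σ => Q.eval (t σ) * f σ) τ := by
  classical
  obtain ⟨S, hS⟩ := hf.exists_finite_poles
  choose n hn using fun s : ℍ => exists_orderAt_mul_pow_nonneg ht (hf.meromorphic s)
  let Q : ℂ[X] := ∏ s ∈ S, (Polynomial.X - Polynomial.C (t s)) ^ n s
  refine ⟨Q, Finset.prod_ne_zero_iff.mpr fun s _ => pow_ne_zero _ (Polynomial.X_sub_C_ne_zero _),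
    fun τ => ?_⟩
  by_cases hτ : 0 ≤ orderAt f τ
  · exact orderAt_mul_nonneg (mdifferentiable_eval ht Q) (hf.meromorphic τ) hτ
  obtain ⟨s, hs, γ, hγ, rfl⟩ := hS τ (not_le.mp hτ)
  rw [← orderAt_smul (mapGL_det_pos γ)]
  have hγ' := mapGL_mem_Gamma0Star hγ
  let R : ℂ[X] := ∏ s' ∈ S.erase s, (Polynomial.X - Polynomial.C (t s')) ^ n s'
  -- At a pole `γ s`, invariance moves the question to `s`, where the factor belonging to `s`
  -- already removes the pole.
  have hQR (x : ℂ) : Q.eval x = R.eval x * (x - t s) ^ n s := by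
    have : Q = (Polynomial.X - Polynomial.C (t s)) ^ n s * R := (Finset.mul_prod_erase S _ hs).symm
    rw [this]
    simp [mul_comm]
  have hcongr : orderAt (fun σ => Q.eval (t (Matrix.SpecialLinearGroup.mapGL ℝ γ • σ)) *
      f (Matrix.SpecialLinearGroup.mapGL ℝ γ • σ)) s =
      orderAt (fun σ => R.eval (t σ) * ((t σ - t s) ^ n s * f σ)) s := by
    apply orderAt_congr
    filter_upwards [eventually_codiscrete_iff.mp (hf.invariant _ hγ') s] with σ hσ
    rw [hσ, hinv _ hγ', hQR, mul_assoc]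
  rw [hcongr]
  refine orderAt_mul_nonneg (mdifferentiable_eval ht R) ?_ (hn s)
  have han : AnalyticAt ℂ (fun z : ℂ => (t (ofComplex z) - t s) ^ n s) s :=
    ((analyticAt_comp_ofComplex ht s).sub analyticAt_const).pow _
  exact han.meromorphicAt.mul (hf.meromorphic s)

end Poles

/-! ### Growth at the cusps -/

section Growth

open scoped Manifold

lemma eventually_eq_of_codiscrete {u v : ℍ → ℂ} (hu : Continuous u)
    (hv : ∀ᶠ τ in atImInfty, ContinuousAt v τ) {A : ℝ}
    (h : ∀ᶠ τ in codiscrete ℍ, A < τ.im → u τ = v τ) : ∀ᶠ τ in atImInfty, u τ = v τ := by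
  have hA : ∀ᶠ τ : ℍ in atImInfty, A < τ.im := tendsto_comap.eventually (eventually_gt_atTop A)
  filter_upwards [hv, hA] with τ hτ hAτ
  refine tendsto_nhds_unique_of_eventuallyEq (hu.continuousAt.mono_left nhdsWithin_le_nhds)
    (hτ.mono_left nhdsWithin_le_nhds) (l := 𝓝[≠] τ) ?_
  filter_upwards [eventually_codiscrete_iff.mp h τ, nhdsWithin_le_nhds
    (continuous_im.continuousAt.eventually (lt_mem_nhds hAτ))] with σ h1 h2
  exact h1 h2

/-- The function `u` has at most a pole at `i∞`, in the sense that `u t₆ᵏ` is bounded there for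
some `k`. -/
def HasModerateGrowth (u : ℍ → ℂ) : Prop :=
  ∃ k : ℕ, IsBoundedAtImInfty fun τ => u τ * t6 τ ^ k

lemma isBoundedAtImInfty_t6_pow (k : ℕ) : IsBoundedAtImInfty fun τ => t6 τ ^ k :=
  (tendsto_t6.pow k).isBigO_one ℝ

lemma IsBoundedAtImInfty.fun_mul {u v : ℍ → ℂ} (hu : IsBoundedAtImInfty u)
    (hv : IsBoundedAtImInfty v) : IsBoundedAtImInfty fun τ => u τ * v τ :=
  BoundedAtFilter.mul hu hv

lemma IsBoundedAtImInfty.mul_t6_pow {u : ℍ → ℂ} {k : ℕ}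
    (hu : IsBoundedAtImInfty fun τ => u τ * t6 τ ^ k) (l : ℕ) :
    IsBoundedAtImInfty fun τ => u τ * t6 τ ^ (k + l) := by
  refine (IsBoundedAtImInfty.fun_mul hu (isBoundedAtImInfty_t6_pow l)).congr_left fun τ => ?_
  ring

lemma HasModerateGrowth.mul {u v : ℍ → ℂ} (hu : HasModerateGrowth u) (hv : HasModerateGrowth v) :
    HasModerateGrowth fun τ => u τ * v τ := by
  obtain ⟨k, hk⟩ := hu
  obtain ⟨l, hl⟩ := hv
  refine ⟨k + l, (IsBoundedAtImInfty.fun_mul hk hl).congr_left fun τ => ?_⟩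
  ring

lemma HasModerateGrowth.add {u v : ℍ → ℂ} (hu : HasModerateGrowth u) (hv : HasModerateGrowth v) :
    HasModerateGrowth fun τ => u τ + v τ := by
  obtain ⟨k, hk⟩ := hu
  obtain ⟨l, hl⟩ := hv
  refine ⟨k + l, Asymptotics.IsBigO.congr_left (BoundedAtFilter.add
    (IsBoundedAtImInfty.mul_t6_pow hk l) (IsBoundedAtImInfty.mul_t6_pow hl k)) fun τ => ?_⟩
  simp only [Pi.add_apply]
  ring

lemma hasModerateGrowth_const (c : ℂ) : HasModerateGrowth fun _ => c :=
  ⟨0, (const_boundedAtFilter atImInfty c).congr_left fun τ => by simp⟩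

lemma HasModerateGrowth.eval {u : ℍ → ℂ} (hu : HasModerateGrowth u) (Q : ℂ[X]) :
    HasModerateGrowth fun τ => Q.eval (u τ) := by
  induction Q using Polynomial.induction_on' with
  | add p q hp hq => simpa using hp.add hq
  | monomial n a =>
    simp only [Polynomial.eval_monomial]
    refine (hasModerateGrowth_const a).mul ?_
    induction n with
    | zero => simpa using hasModerateGrowth_const 1
    | succ n ih => simpa only [pow_succ] using ih.mul hu

lemma HasModerateGrowth.congr {u v : ℍ → ℂ} (hu : HasModerateGrowth u)
    (h : ∀ᶠ τ in atImInfty, u τ = v τ) : HasModerateGrowth v := by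
  obtain ⟨k, hk⟩ := hu
  refine ⟨k, Asymptotics.IsBigO.congr' hk ?_ EventuallyEq.rfl⟩
  filter_upwards [h] with τ hτ
  rw [hτ]

lemma hasModerateGrowth_t6 : HasModerateGrowth t6 :=
  ⟨0, by simpa using isBoundedAtImInfty_t6_pow 1⟩

lemma hasModerateGrowth_t6_atkinLehnerThree :
    HasModerateGrowth fun τ => t6 (atkinLehnerThree • τ) := by
  refine ⟨1, Asymptotics.IsBigO.congr_left (const_boundedAtFilter atImInfty (1 : ℂ)) fun τ => ?_⟩
  simp [t6_atkinLehnerThree_smul, t6_ne_zero τ]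

lemma hasModerateGrowth_of_meromorphicAt {F : ℂ → ℂ} (hF : MeromorphicAt F 0) {w : ℝ}
    (hw : 0 < w) : HasModerateGrowth fun τ => F (Function.Periodic.qParam w τ) := by
  obtain ⟨n, hn⟩ := hF
  have h1 : IsBoundedAtImInfty fun τ : ℍ => Function.Periodic.qParam w τ ^ n *
      F (Function.Periodic.qParam w τ) := by
    have := (hn.continuousAt.tendsto.comp (qParam_tendsto_atImInfty hw)).isBigO_one ℝ
    refine this.congr_left fun τ => ?_
    simp
  -- With `k ≥ n / w`, the power `qᵏ` decays at least as fast as the `n`-th power of the parameter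
  -- of width `w`.
  obtain ⟨k, hk⟩ := exists_nat_ge (n / w)
  have h2 : IsBoundedAtImInfty fun τ : ℍ => (t6 τ / nome τ) ^ k :=
    (tendsto_t6_div.pow k).isBigO_one ℝ
  have h3 : IsBoundedAtImInfty fun τ : ℍ => nome τ ^ k / Function.Periodic.qParam w τ ^ n := by
    rw [isBoundedAtImInfty_iff]
    refine ⟨1, 0, fun τ _ => ?_⟩
    rw [norm_div, norm_pow, norm_pow, norm_nome, Function.Periodic.norm_qParam,
      div_le_one (by positivity), ← Real.exp_nat_mul, ← Real.exp_nat_mul, Real.exp_le_exp]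
    have hpos := mul_pos (mul_pos two_pos Real.pi_pos) τ.im_pos
    rw [coe_im, show (n : ℝ) * (-2 * Real.pi * τ.im / w) = -(n / w * (2 * Real.pi * τ.im)) by ring,
      show (k : ℝ) * (-2 * Real.pi * τ.im) = -(k * (2 * Real.pi * τ.im)) by ring, neg_le_neg_iff]
    exact mul_le_mul_of_nonneg_right hk hpos.le
  refine ⟨k, (IsBoundedAtImInfty.fun_mul (IsBoundedAtImInfty.fun_mul h1 h2) h3).congr_left
    fun τ => ?_⟩
  have := nome_ne_zero τ
  have : Function.Periodic.qParam w (τ : ℂ) ≠ 0 := Function.Periodic.qParam_ne_zero _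
  rw [div_pow]
  field_simp

/-- Equality off a discrete set becomes equality everywhere high up, since both sides are continuous
there. -/
lemma hasModerateGrowth_of_expansion {f h : ℍ → ℂ} {Q : ℂ[X]} (hh : Continuous h)
    (hfh : ∀ᶠ τ in codiscrete ℍ, Q.eval (t6 τ) * f τ = h τ) {M : GL (Fin 2) ℝ}
    (hM : 0 < M.val.det) (hf : MeromorphicAtCusp f (M • OnePoint.infty))
    (ht : HasModerateGrowth fun τ => t6 (M • τ)) : HasModerateGrowth fun τ => h (M • τ) := by
  obtain ⟨w, hw, F, hF, A, hfF⟩ := hf.exists_expansion hM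
  refine ((ht.eval Q).mul (hasModerateGrowth_of_meromorphicAt hF hw)).congr ?_
  have hcont : ∀ᶠ τ : ℍ in atImInfty, ContinuousAt (fun τ : ℍ => Q.eval (t6 (M • τ)) *
      F (Function.Periodic.qParam w τ)) τ := by
    filter_upwards [eventually_atImInfty_of_nhdsNE hw hF.eventually_analyticAt] with τ hτ
    refine ((mdifferentiable_eval mdifferentiable_t6 Q).continuous.comp
      (continuous_const_smul M)).continuousAt.mul ?_
    exact ContinuousAt.comp (f := fun τ : ℍ => Function.Periodic.qParam w τ) hτ.continuousAt
      (Function.Periodic.continuous_qParam.comp continuous_coe).continuousAt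
  have key := eventually_eq_of_codiscrete (A := A) (hh.comp (continuous_const_smul M)) hcont (by
    filter_upwards [hfF, eventually_codiscrete_smul hfh M] with τ h1 h2 hA
    rw [Function.comp_apply, ← h2, h1 hA])
  filter_upwards [key] with τ hτ
  exact hτ.symm

lemma atkinLehnerThree_smul_infty : atkinLehnerThree • (OnePoint.infty : OnePoint ℝ) =
    Matrix.SpecialLinearGroup.mapGL ℝ (lowerUnipotent 2) • OnePoint.infty := by
  rw [OnePoint.smul_infty_eq_ite, OnePoint.smul_infty_eq_ite]
  simp only [mapGL_real_apply]
  norm_num [atkinLehnerThree, Matrix.GeneralLinearGroup.mkOfDetNeZero, lowerUnipotent]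

/-- The conjugate `W₃ T W₃⁻¹` lies in `Γ₀(6)`; this makes `h ∘ W₃` a function of `q`. -/
lemma smul_atkinLehnerThree_T {h : ℍ → ℂ} (hinv : ∀ γ ∈ Gamma0Star 6, ∀ τ, h (γ • τ) = h τ)
    (τ : ℍ) : h (atkinLehnerThree • ModularGroup.T • τ) = h (atkinLehnerThree • τ) := by
  let γ : SL(2, ℤ) := ⟨!![-5, 3; -12, 7], by norm_num [Matrix.det_fin_two_of]⟩
  have hγ : γ ∈ CongruenceSubgroup.Gamma0 6 := by
    rw [CongruenceSubgroup.Gamma0_mem]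
    simp only [γ]
    decide
  have hmul : atkinLehnerThree * Matrix.SpecialLinearGroup.mapGL ℝ ModularGroup.T =
      Matrix.SpecialLinearGroup.mapGL ℝ γ * atkinLehnerThree := by
    ext i j
    simp only [Units.val_mul, Matrix.mul_apply, Fin.sum_univ_two, mapGL_real_apply,
      ModularGroup.coe_T]
    fin_cases i <;> fin_cases j <;>
    norm_num [atkinLehnerThree, Matrix.GeneralLinearGroup.mkOfDetNeZero, γ]
  rw [ModularGroup.sl_moeb, smul_smul]
  change h ((_ * Matrix.SpecialLinearGroup.mapGL ℝ ModularGroup.T) • τ) = _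
  rw [hmul, mul_smul, hinv _ (mapGL_mem_Gamma0Star hγ)]

/-- A holomorphic `Γ₀(6)*`-invariant function that is bounded at `i∞` and has at most a pole at the
other cusp is a polynomial in `t₆`. -/
lemma exists_polynomial_of_isBoundedAtImInfty (k : ℕ) : ∀ h : ℍ → ℂ, MDiff h →
    (∀ γ ∈ Gamma0Star 6, ∀ τ, h (γ • τ) = h τ) → IsBoundedAtImInfty h →
    IsBoundedAtImInfty (fun τ => h (atkinLehnerThree • τ) * t6 τ ^ k) →
    ∃ p : ℂ[X], ∀ τ, h τ = p.eval (t6 τ) := by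
  induction k with
  | zero =>
    intro h hd hinv hb hb'
    obtain ⟨c, hc⟩ := exists_eq_const_of_invariant hd hinv hb (by simpa using hb')
    exact ⟨Polynomial.C c, by simpa using hc⟩
  | succ k ih =>
    intro h hd hinv hb hb'
    have hdet : 0 < atkinLehnerThree.det.val := by
      rw [Matrix.GeneralLinearGroup.val_det_apply, det_atkinLehnerThree]; norm_num
    let φ : ℍ → ℂ := fun τ => h (atkinLehnerThree • τ) * t6 τ ^ (k + 1)
    have hφd : MDiff φ :=
      (hd.comp (mdifferentiable_smul hdet)).mul (mdifferentiable_t6.pow (k + 1))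
    have hper : Function.Periodic (φ ∘ ofComplex) (1 : ℝ) := by
      refine periodic_comp_ofComplex_of_T fun τ => ?_
      simp only [φ]
      rw [smul_atkinLehnerThree_T hinv, smul_T_of_Gamma0Star t6_smul]
    have hdecay := exp_decay_sub_atImInfty one_pos hper hφd hb'
    set v := valueAtInfty φ
    -- Since `t₆ ∘ W₃ = 1/t₆`, subtracting `v t₆ᵏ⁺¹` removes the leading polar term at the cusp
    -- `1/2`: after `W₃`, `h' t₆ᵏ` becomes `(φ - v)/t₆`, and `φ - v = O(q)`.
    let h' : ℍ → ℂ := fun τ => h τ - v * t6 τ ^ (k + 1)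
    have hd' : MDiff h' := hd.sub ((mdifferentiable_t6.pow (k + 1)).const_smul v)
    have hinv' : ∀ γ ∈ Gamma0Star 6, ∀ τ, h' (γ • τ) = h' τ := fun γ hγ τ => by
      simp only [h', hinv γ hγ, t6_smul γ hγ]
    have hbd : IsBoundedAtImInfty h' :=
      Asymptotics.IsBigO.sub hb (IsBoundedAtImInfty.fun_mul
        (const_boundedAtFilter atImInfty v) (isBoundedAtImInfty_t6_pow (k + 1)))
    have hquot : IsBoundedAtImInfty fun τ => (φ τ - v) / nome τ := by
      obtain ⟨C, hC⟩ := hdecay.bound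
      refine Asymptotics.IsBigO.of_bound C ?_
      filter_upwards [hC] with τ hτ
      rw [norm_div, norm_nome, div_le_iff₀ (Real.exp_pos _)]
      simpa using hτ
    have hinvt : IsBoundedAtImInfty fun τ => (t6 τ / nome τ)⁻¹ :=
      (tendsto_t6_div.inv₀ one_ne_zero).isBigO_one ℝ
    have hbd' : IsBoundedAtImInfty fun τ => h' (atkinLehnerThree • τ) * t6 τ ^ k := by
      refine (IsBoundedAtImInfty.fun_mul hquot hinvt).congr_left fun τ => ?_
      have h1 := nome_ne_zero τ
      have h2 := t6_ne_zero τ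
      simp only [φ, h', t6_atkinLehnerThree_smul, inv_pow]
      field_simp
      ring
    obtain ⟨p, hp⟩ := ih h' hd' hinv' hbd hbd'
    refine ⟨p + Polynomial.C v * Polynomial.X ^ (k + 1), fun τ => ?_⟩
    rw [Polynomial.eval_add, ← hp]
    simp [h']

end Growth

/-! ### Generators of the function field -/

section Hauptmodul

open scoped Manifold

/-- Otherwise `t₆` is constant by the identity theorem; its limit `0` at `i∞` contradicts its
nonvanishing. -/
lemma eventually_codiscrete_t6_ne (c : ℂ) : ∀ᶠ τ in codiscrete ℍ, t6 τ ≠ c := by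
  rw [eventually_codiscrete_iff]
  intro τ
  by_contra h
  have hfreq : ∃ᶠ σ in 𝓝[≠] τ, t6 σ - c = 0 := by
    simp only [Filter.Frequently, sub_eq_zero]
    exact h
  have hzero := UpperHalfPlane.eq_zero_of_frequently
    (mdifferentiable_t6.sub (mdifferentiable_const (c := c))) hfreq
  have hconst (σ : ℍ) : t6 σ = c := sub_eq_zero.mp (congrFun hzero σ)
  have hc : c = 0 := tendsto_nhds_unique (tendsto_const_nhds.congr fun σ => (hconst σ).symm)
    tendsto_t6
  exact t6_ne_zero τ ((hconst τ).trans hc)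

lemma eventually_codiscrete_eval_t6_ne_zero {Q : ℂ[X]} (hQ : Q ≠ 0) :
    ∀ᶠ τ in codiscrete ℍ, Q.eval (t6 τ) ≠ 0 := by
  filter_upwards [(Finset.eventually_all Q.roots.toFinset).mpr
    fun c _ => eventually_codiscrete_t6_ne c] with τ hτ h0
  exact hτ _ (by simpa [hQ] using h0) rfl

instance codiscrete_neBot : NeBot (codiscrete ℍ) := by
  rw [neBot_iff]
  intro h
  have hfalse : ∀ᶠ _ in codiscrete ℍ, (0 : ℂ) = 1 := by simp [h]
  exact zero_ne_one (eq_of_eventually_codiscrete hfalse (τ := I) continuousAt_const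
    continuousAt_const)

lemma IsAutomorphicFunction.exists_eq_eval_t6_div {f : ℍ → ℂ}
    (hf : IsAutomorphicFunction (Gamma0Star 6) f) : ∃ P Q : ℂ[X],
    ∀ᶠ τ in codiscrete ℍ, Q.eval (t6 τ) ≠ 0 ∧ f τ = P.eval (t6 τ) / Q.eval (t6 τ) := by
  obtain ⟨Q, hQ, hord⟩ := hf.exists_polynomial_orderAt_nonneg mdifferentiable_t6 t6_smul
  obtain ⟨h, hd, hfh⟩ := exists_mdifferentiable_of_orderAt_nonneg (fun τ =>
    (analyticAt_comp_ofComplex (mdifferentiable_eval mdifferentiable_t6 Q) τ).meromorphicAt.mul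
      (hf.meromorphic τ)) hord
  have hinv : ∀ γ ∈ Gamma0Star 6, ∀ τ, h (γ • τ) = h τ := by
    intro γ hγ τ
    refine eq_of_eventually_codiscrete (u := fun τ => h (γ • τ)) ?_
      (hd.continuous.comp (continuous_const_smul γ)).continuousAt hd.continuous.continuousAt
    filter_upwards [hfh, eventually_codiscrete_smul hfh γ, hf.invariant γ hγ] with σ h1 h2 h3
    rw [← h1, ← h2, h3, t6_smul γ hγ]
  have hcusp (M : GL (Fin 2) ℝ) (g : SL(2, ℤ)) (hg : M • (OnePoint.infty : OnePoint ℝ) =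
      Matrix.SpecialLinearGroup.mapGL ℝ g • OnePoint.infty) :
      MeromorphicAtCusp f (M • OnePoint.infty) :=
    hf.meromorphic_cusps _ (hg ▸ isCusp_Gamma0Star g)
  obtain ⟨k, hk⟩ : HasModerateGrowth h := by
    simpa using hasModerateGrowth_of_expansion (M := 1) hd.continuous hfh (by simp)
      (hcusp 1 1 (by simp)) (by simpa using hasModerateGrowth_t6)
  obtain ⟨l, hl⟩ := hasModerateGrowth_of_expansion hd.continuous hfh
    (by rw [det_atkinLehnerThree]; norm_num) (hcusp _ _ atkinLehnerThree_smul_infty)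
    hasModerateGrowth_t6_atkinLehnerThree
  -- The factor `t₆ᵏ` bounds the function at `∞` at the price of a pole of order up to `k + l` at
  -- `1/2`.
  obtain ⟨P, hP⟩ := exists_polynomial_of_isBoundedAtImInfty (k + l) (fun τ => h τ * t6 τ ^ k)
    (hd.mul (mdifferentiable_t6.pow k)) (fun γ hγ τ => by rw [hinv γ hγ, t6_smul γ hγ]) hk
    (hl.congr_left fun τ => by
      have := t6_ne_zero τ
      rw [t6_atkinLehnerThree_smul, inv_pow, pow_add]
      field_simp)
  refine ⟨P, Polynomial.X ^ k * Q, ?_⟩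
  filter_upwards [hfh, eventually_codiscrete_eval_t6_ne_zero hQ] with τ h1 h2
  have h3 := pow_ne_zero k (t6_ne_zero τ)
  rw [Polynomial.eval_mul, Polynomial.eval_pow, Polynomial.eval_X, ← hP, ← h1]
  exact ⟨mul_ne_zero h3 h2, by field_simp⟩

lemma isHauptmodul_t6 : IsHauptmodul (Gamma0Star 6) t6 where
  automorphic := isAutomorphicFunction_t6
  nonconstant := by
    rintro ⟨c, hc⟩
    obtain ⟨τ, h1, h2⟩ := (hc.and (eventually_codiscrete_t6_ne c)).exists
    exact h2 h1
  generates _ hf := hf.exists_eq_eval_t6_div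

/-- Homogenization of a polynomial in two linear forms. -/
lemma Polynomial.exists_eval_homogenize {K : Type*} [Field K] (A B P : K[X]) :
    ∃ (R : K[X]) (n : ℕ), ∀ x, B.eval x ≠ 0 →
      R.eval x = B.eval x ^ n * P.eval (A.eval x / B.eval x) := by
  induction P using Polynomial.induction_on' with
  | add p q hp hq =>
    obtain ⟨R, n, hR⟩ := hp
    obtain ⟨S, m, hS⟩ := hq
    refine ⟨B ^ m * R + B ^ n * S, n + m, fun x hx => ?_⟩
    simp only [Polynomial.eval_add, Polynomial.eval_mul, Polynomial.eval_pow, hR x hx, hS x hx]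
    ring
  | monomial n a =>
    refine ⟨Polynomial.C a * A ^ n, n, fun x hx => ?_⟩
    simp only [Polynomial.eval_mul, Polynomial.eval_C, Polynomial.eval_pow,
      Polynomial.eval_monomial, div_pow]
    field_simp

variable {G : Subgroup (GL (Fin 2) ℝ)} {h : ℍ → ℂ} {a b c d : ℂ}

lemma IsAutomorphicFunction.moebius (hh : IsAutomorphicFunction G h) (a b c d : ℂ) :
    IsAutomorphicFunction G fun τ => (a * h τ + b) / (c * h τ + d) where
  meromorphic τ := by
    have := hh.meromorphic τ
    exact (((MeromorphicAt.const a _).mul this).add (MeromorphicAt.const b _)).div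
      (((MeromorphicAt.const c _).mul this).add (MeromorphicAt.const d _))
  invariant γ hγ := by
    filter_upwards [hh.invariant γ hγ] with τ hτ
    rw [hτ]
  meromorphic_cusps κ hκ g hg := by
    obtain ⟨w, hw, F, hF, A, hA⟩ := hh.meromorphic_cusps κ hκ g hg
    refine ⟨w, hw, fun q => (a * F q + b) / (c * F q + d), by fun_prop, A, ?_⟩
    filter_upwards [hA] with τ hτ hτ'
    rw [hτ hτ']

/-- A Möbius transform of a Hauptmodul is a Hauptmodul. -/
lemma IsHauptmodul.moebius (hh : IsHauptmodul G h) (hdet : a * d - b * c ≠ 0)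
    (hden : ∀ᶠ τ in codiscrete ℍ, c * h τ + d ≠ 0) :
    IsHauptmodul G fun τ => (a * h τ + b) / (c * h τ + d) := by
  -- The inverse transform is `x ↦ (dx - b)/(a - cx)`; its denominator equals `(ad - bc)/(ch + d)`.
  have hinv : ∀ᶠ τ in codiscrete ℍ,
      a - c * ((a * h τ + b) / (c * h τ + d)) ≠ 0 ∧
      h τ = (d * ((a * h τ + b) / (c * h τ + d)) - b) /
        (a - c * ((a * h τ + b) / (c * h τ + d))) := by
    filter_upwards [hden] with τ hτ
    have h1 : a - c * ((a * h τ + b) / (c * h τ + d)) = (a * d - b * c) / (c * h τ + d) := by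
      field_simp
      ring
    have h2 : d * ((a * h τ + b) / (c * h τ + d)) - b =
        (a * d - b * c) * h τ / (c * h τ + d) := by
      rw [eq_div_iff hτ, sub_mul, mul_assoc d, div_mul_cancel₀ _ hτ]
      ring
    rw [h1, h2, div_div_div_cancel_right₀ hτ, mul_div_cancel_left₀ _ hdet]
    exact ⟨div_ne_zero hdet hτ, rfl⟩
  refine ⟨hh.automorphic.moebius a b c d, ?_, fun f hf => ?_⟩
  · rintro ⟨e, he⟩
    refine hh.nonconstant ⟨(d * e - b) / (a - c * e), ?_⟩
    filter_upwards [hinv, he] with τ h1 h2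
    rw [← h2]
    exact h1.2
  · obtain ⟨P, Q, hPQ⟩ := hh.generates f hf
    let A : ℂ[X] := Polynomial.C d * Polynomial.X - Polynomial.C b
    let B : ℂ[X] := Polynomial.C a - Polynomial.C c * Polynomial.X
    obtain ⟨R, n, hR⟩ := Polynomial.exists_eval_homogenize A B P
    obtain ⟨S, m, hS⟩ := Polynomial.exists_eval_homogenize A B Q
    -- The powers of `B` are crossed to balance the exponents `n` and `m` used to clear
    -- denominators.
    refine ⟨R * B ^ m, S * B ^ n, ?_⟩
    filter_upwards [hinv, hPQ] with τ ⟨h1, h2⟩ ⟨h3, h4⟩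
    set x := (a * h τ + b) / (c * h τ + d)
    have hA : A.eval x = d * x - b := by simp [A]
    have hB : B.eval x = a - c * x := by simp [B]
    simp only [Polynomial.eval_mul, Polynomial.eval_pow, hR x (hB ▸ h1), hS x (hB ▸ h1), hA, hB,
      ← h2, h4]
    exact ⟨by simp [h1, h3], by field_simp⟩

lemma isHauptmodul_E06_div_E16 : IsHauptmodul (Gamma0Star 6) fun τ => E06 τ / E16 τ := by
  have := isHauptmodul_t6.moebius (a := -24) (b := 0) (c := -5) (d := 1) (by norm_num) (by
    filter_upwards [eventually_codiscrete_t6_ne (1 / 5)] with τ hτ h0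
    exact hτ (by linear_combination (-1 / 5) * h0))
  convert this using 2 with τ
  rw [E06_div_E16]
  ring

end Hauptmodul

theorem mainTheorem3 :
    IsHauptmodul (Gamma0Star 6) (fun τ => E06 τ / E16 τ) ∧
    IsHauptmodul (Gamma0Star 6) t6 ∧
    (∀ τ : ℍ, (E16 τ = 0 ↔ 1 - 5 * t6 τ = 0) ∧
      (E16 τ ≠ 0 → -(1 / 24 : ℂ) * (E06 τ / E16 τ) = t6 τ / (1 - 5 * t6 τ))) := by
  refine ⟨isHauptmodul_E06_div_E16, isHauptmodul_t6, fun τ => ⟨E16_eq_zero_iff τ, fun _ => ?_⟩⟩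
  rw [E06_div_E16]
  ring
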